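/- All matroids are finite. For a matroid $M$ with rank function $r_M$ and $Z\subseteq E(M)$, write $\lambda_M(Z)=r_M(Z)+r_M(E(M)-Z)-r(M)$. A $\mathrm{PG}(n-1,q)$-minor (restriction) of $M$ is a minor (restriction) of $M$ isomorphic to the rank-$n$ projective geometry $\mathrm{PG}(n-1,q)$ over $\mathrm{GF}(q)$. If $N$ is a $\mathrm{PG}(n-1,q)$-minor of $M$, let $\mathcal T_n(N)$ be the collection of sets $Z\subseteq E(N)$ with $\lambda_N(Z)<n-1$ that are neither spanning nor cospanning in $N$, and let $$\mathcal T_n(M,N)=\{Z\subseteq E(M):\ \lambda_M(Z)<n-1,\ Z\cap E(N)\in\mathcal T_n(N)\}$$ (the tangle of order $n$ on $M$ induced by $\mathcal T_n(N)$). For $X\subseteq E(M)$ let $\kappa_{\mathcal T_n(M,N)}(X)=\min\{\lambda_M(Z): X\subseteq Z\in\mathcal T_n(M,N)\}$ if $X$ is contained in some member of $\mathcal T_n(M,N)$, and $\kappa_{\mathcal T_n(M,N)}(X)=n-1$ otherwise. **Lemma.** Let $q$ be a prime power, let $h,a$ be positive integers with $a\le h$, and let $n=2h(1+q^{h+a})+a+2$.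 Let $M$ be a matroid with a $\mathrm{PG}(n-1,q)$-minor $N$, and let $X\subseteq E(M)$ be a set such that $r_M(X)\le a$ and $M\setminus X$ is $\mathrm{GF}(q)$-representable. Then there are a minor $M'$ of $M$ and a $\mathrm{PG}(h-1,q)$-restriction $N'$ of $M'$ such that $E(M')=E(N')\cup X$, $M'|X=M|X$ and $\lambda_{M'}(X)=\kappa_{\mathcal T_n(M,N)}(X)$. -/

import Mathlib

open scoped Matroid

namespace Matroid

/-- The linear (vector) matroid over the field `F` on the ground set `E`, represented by the family
of vectors `v`: a subset of `E` is independent iff the corresponding family of vectors is linearly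
independent over `F`. -/
def vectorMatroid (F : Type*) {α W : Type*} [Field F] [AddCommGroup W] [Module F W]
    (v : α → W) (E : Set α) : Matroid α :=
  (IndepMatroid.ofFinitary E (fun I => I ⊆ E ∧ LinearIndepOn F v I)
    ⟨Set.empty_subset E, linearIndepOn_empty F v⟩
    (fun _ _ hJ hIJ => ⟨hIJ.trans hJ.1, hJ.2.mono hIJ⟩)
    (by
      intro I B hI hImax hB
      by_contra! hcon
      have hBI : v '' B ⊆ Submodule.span F (v '' I) := by
        rintro _ ⟨x, hx, rfl⟩
        by_contra hxI
        have hxnI : x ∉ I := fun h => hxI (Submodule.subset_span ⟨x, h, rfl⟩)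
        exact hcon x ⟨hx, hxnI⟩
          (Set.insert_subset (hB.prop.1 hx) hI.1) (hI.2.insert hxI)
      refine hImax ⟨hI, fun J hJ hIJ e heJ => ?_⟩
      by_contra heI
      have heB : v e ∈ Submodule.span F (v '' B) := by
        by_contra h
        have heB : e ∈ B := hB.le_of_ge
          ⟨Set.insert_subset (hJ.1 heJ) hB.prop.1, hB.prop.2.insert h⟩
          (Set.subset_insert e B) (Set.mem_insert e B)
        exact h (Submodule.subset_span ⟨e, heB, rfl⟩)
      have heI' : v e ∈ Submodule.span F (v '' I) := Submodule.span_le.2 hBI heB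
      have hins : LinearIndepOn F v (insert e I) := hJ.2.mono (Set.insert_subset heJ hIJ)
      exact ((linearIndepOn_insert heI).1 hins).2 heI')
    (fun I h => ⟨fun e he => (h {e} (by simpa using he) (Set.finite_singleton e)).1 rfl,
      linearIndepOn_of_finite I fun J hJ hfin => (h J hJ hfin).2⟩)
    (fun _ hI => hI.1)).matroid

theorem vectorMatroid_indep_iff {F α W : Type*} [Field F] [AddCommGroup W] [Module F W]
    {v : α → W} {E I : Set α} :
    (vectorMatroid F v E).Indep I ↔ I ⊆ E ∧ LinearIndepOn F v I := Iff.rfl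

theorem vectorMatroid_ground {F α W : Type*} [Field F] [AddCommGroup W] [Module F W]
    {v : α → W} {E : Set α} : (vectorMatroid F v E).E = E := rfl

/-- `M` is representable over `F`: it is the vector matroid of a family of columns in some `F ^ k`
indexed by the ground set. -/
def IsRepresentableOver {α : Type*} (M : Matroid α) (F : Type*) [Field F] : Prop :=
  ∃ (k : ℕ) (v : α → Fin k → F), M = vectorMatroid F v M.E

/-- The rank-`n` projective geometry over `F`, that is `PG(n-1, q)` if `F` has `q` elements: its
elements are the points of the projective space of `F ^ n`, and independence is linear
independence. -/
noncomputable def projGeom (F : Type*) [Field F] (n : ℕ) :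
    Matroid (Projectivization F (Fin n → F)) :=
  vectorMatroid F (fun x => x.rep) Set.univ

/-- `N` is isomorphic to the rank-`n` projective geometry over `F`. -/
def IsProjGeom {α : Type*} (N : Matroid α) (F : Type*) [Field F] (n : ℕ) : Prop :=
  ∃ (f : Projectivization F (Fin n → F) → α) (hf : Set.InjOn f (projGeom F n).E),
    N = (projGeom F n).map f hf

/-- The rank `r_M(X)` as a natural number (all matroids in use have finite rank). -/
noncomputable def rk {α : Type*} (M : Matroid α) (X : Set α) : ℕ := (M.eRk X).toNat

/-- The connectivity function `λ_M(X) = r_M(X) + r_M(E(M) - X) - r(M)`. The subtraction does not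
truncate, see `lam_add_rk`. -/
noncomputable def lam {α : Type*} (M : Matroid α) (X : Set α) : ℕ :=
  M.rk X + M.rk (M.E \ X) - M.rk M.E

theorem lam_add_rk {α : Type*} (M : Matroid α) [M.RankFinite] (X : Set α) :
    M.lam X + M.rk M.E = M.rk X + M.rk (M.E \ X) := by
  have h : M.eRk M.E ≤ M.eRk X + M.eRk (M.E \ X) :=
    (M.eRk_mono (by intro e he; by_cases h : e ∈ X <;> simp [h, he])).trans
      (M.eRk_union_le_eRk_add_eRk X (M.E \ X))
  have hX : M.eRk X ≠ ⊤ := M.eRk_ne_top_iff.2 (M.isRkFinite_set X)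
  have hY : M.eRk (M.E \ X) ≠ ⊤ := M.eRk_ne_top_iff.2 (M.isRkFinite_set _)
  have h' := ENat.toNat_le_toNat h (by simp [hX, hY])
  rw [ENat.toNat_add hX hY] at h'
  exact Nat.sub_add_cancel h'

/-- `𝒯_k(M)`: the collection of the `(k-1)`-separating sets of `M` (the sets `X ⊆ E(M)` with
`λ_M(X) < k - 1`) that are neither spanning nor cospanning. -/
def tangleSets {α : Type*} (M : Matroid α) (k : ℕ) : Set (Set α) :=
  {X | X ⊆ M.E ∧ M.lam X + 1 < k ∧ ¬ M.Spanning X ∧ ¬ M✶.Spanning X}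

/-- The collection of subsets of `E(M)` induced by a collection `T` (a tangle of order `θ`) on a
minor `N` of `M`: those `X ⊆ E(M)` with `λ_M(X) < θ - 1` and `X ∩ E(N) ∈ T`. -/
def inducedTangle {α : Type*} (M N : Matroid α) (T : Set (Set α)) (θ : ℕ) : Set (Set α) :=
  {X | X ⊆ M.E ∧ M.lam X + 1 < θ ∧ X ∩ N.E ∈ T}

/-- `𝒯_n(M, N)`: the tangle of order `n` on `M` induced by `𝒯_n(N)`. -/
def minorTangle {α : Type*} (M N : Matroid α) (n : ℕ) : Set (Set α) :=
  inducedTangle M N (N.tangleSets n) n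

open Classical in
/-- The tangle connectivity `κ_T(X)` for a tangle `T` of order `θ` on `M`: the minimum of `λ_M(Z)`
over the `T`-small sets `Z` containing `X`, and `θ - 1` if there is no such `Z`. -/
noncomputable def tangleConn {α : Type*} (M : Matroid α) (T : Set (Set α)) (θ : ℕ)
    (X : Set α) : ℕ :=
  if ∃ Z ∈ T, X ⊆ Z then sInf {m | ∃ Z ∈ T, X ⊆ Z ∧ M.lam Z = m} else θ - 1

end Matroid

/-! Write k for the tangle connectivity of X. Since r(X) ≤ a, the set X is itself small, so k ≤ a,
and every set containing X that does not span N has connectivity at least k. If N = M/C\D,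
contracting all of C could destroy this bound. Instead, a maximal S ⊆ C skew to X is contracted
while the bound survives; uncrossing then places C − S inside a set Z ⊇ X with λ(Z) = k
(`exists_contract_subset_tight`). So the part of E(N) outside Z still has almost all points of N,
while its rank in M/S is at most n + k: it is dense in a space over GF(q). Discarding a few elements
makes its rank insensitive to removal of low-rank subsets (`exists_robust_subset`), and Tutte's
Linking Theorem (`exists_minor_linking`) removes everything except X and the remaining set Y, with
λ(X) = k.

The geometry comes from an expansion argument (`exists_translate_of_dense`). Let A be the union of
the lines of Y plus the span of a set T ⊆ Y skew to X, and enlarge T as long as each new element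
multiplies |A| by at least 1 + 1/(h q^h). Density bounds |T|. When the growth stops, A is almost
invariant under h independent directions taken from Y, hence contains a translate of their span U;
the translating vector may be taken to be that of some a ∈ Y outside the closure of X, T and the
directions. After T ∪ {a} is contracted, every point of U is parallel to an element of Y. Density
and robustness keep X connected to this geometry with order k (`le_lam_contract_of_dense`), and a
second use of linking finishes. -/

namespace Matroid

/-! ### Rank and connectivity under minors -/

section Rank

variable {α : Type*} {M N : Matroid α} {A B C D R S T X Y Z : Set α} {e : α}

theorem coe_rk (M : Matroid α) [M.RankFinite] (X : Set α) : (M.rk X : ℕ∞) = M.eRk X :=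
  ENat.natCast_toNat (M.eRk_ne_top_iff.2 (M.isRkFinite_set X))

theorem rk_mono (M : Matroid α) [M.RankFinite] (h : X ⊆ Y) : M.rk X ≤ M.rk Y := by
  have := M.eRk_mono h
  rw [← coe_rk, ← coe_rk] at this
  exact_mod_cast this

theorem rk_inter_add_rk_union_le (M : Matroid α) [M.RankFinite] (X Y : Set α) :
    M.rk (X ∩ Y) + M.rk (X ∪ Y) ≤ M.rk X + M.rk Y := by
  have := M.eRk_inter_add_eRk_union_le X Y
  simp only [← coe_rk] at this
  exact_mod_cast this

theorem rk_union_le (M : Matroid α) [M.RankFinite] (X Y : Set α) :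
    M.rk (X ∪ Y) ≤ M.rk X + M.rk Y := by
  have := M.rk_inter_add_rk_union_le X Y
  omega

theorem rk_inter_ground (M : Matroid α) (X : Set α) : M.rk (X ∩ M.E) = M.rk X := by
  simp [rk]

theorem rk_le_rk_ground (M : Matroid α) [M.RankFinite] (X : Set α) : M.rk X ≤ M.rk M.E := by
  rw [← rk_inter_ground]
  exact M.rk_mono Set.inter_subset_right

theorem rk_empty (M : Matroid α) : M.rk ∅ = 0 := by
  simp [rk]

theorem rk_singleton_le (M : Matroid α) [M.RankFinite] (e : α) : M.rk {e} ≤ 1 := by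
  have := M.eRk_singleton_le e
  rw [← coe_rk] at this
  exact_mod_cast this

theorem rk_le_ncard (M : Matroid α) [M.RankFinite] (hX : X.Finite) : M.rk X ≤ X.ncard := by
  have := M.eRk_le_encard X
  rw [← coe_rk, ← hX.cast_ncard_eq] at this
  exact_mod_cast this

theorem indep_iff_rk_eq_ncard (M : Matroid α) [M.RankFinite] (hX : X.Finite) :
    M.Indep X ↔ M.rk X = X.ncard := by
  rw [indep_iff_eRk_eq_encard_of_finite hX, ← coe_rk, ← hX.cast_ncard_eq]
  exact_mod_cast Iff.rfl

theorem rk_restrict (M : Matroid α) (h : A ⊆ R) : (M ↾ R).rk A = M.rk A := by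
  rw [rk, restrict_eRk_eq _ h, rk]

theorem rk_delete (M : Matroid α) (h : Disjoint A D) : (M ＼ D).rk A = M.rk A := by
  rw [delete_eq_restrict, rk, restrict_eRk_eq', rk, ← Set.inter_sdiff_assoc,
    (h.mono_left Set.inter_subset_left).sdiff_eq_left, eRk_inter_ground]

/-- Extend a basis `J` of `C` to a basis `I` of `A ∪ C`; then `I \ J` is a basis of `A` in the
contraction. -/
theorem rk_contract_add (M : Matroid α) [M.RankFinite] (C A : Set α) :
    (M ／ C).rk A + M.rk C = M.rk (A ∪ C) := by
  obtain ⟨J, hJ⟩ := M.exists_isBasis' C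
  obtain ⟨I, hI, hJI⟩ := hJ.indep.subset_isBasis'_of_subset (hJ.subset.trans
    (Set.subset_union_right (s := A)))
  have hIC : I ∩ C = J := (hJ.eq_of_subset_indep (hI.indep.subset Set.inter_subset_left)
    (Set.subset_inter hJI hJ.subset) Set.inter_subset_right).symm
  have hIJ : I \ J = I \ C := by rw [← hIC, Set.sdiff_self_inter]
  have hb : (M ／ C).IsBasis' (I \ J) A := by
    refine ⟨⟨?_, ?_⟩, ?_⟩
    · rw [hJ.contract_indep_iff, Set.sdiff_union_of_subset hJI, hIJ]
      exact ⟨hI.indep, Set.disjoint_sdiff_right⟩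
    · rw [hIJ]
      rintro x ⟨hx, hxC⟩
      exact (hI.subset hx).resolve_right hxC
    · rintro K ⟨hK, hKA⟩ hle
      rw [hJ.contract_indep_iff] at hK
      have : I = K ∪ J := hI.eq_of_subset_indep hK.1
        (by rw [← Set.sdiff_union_of_subset hJI]; exact Set.union_subset_union_left _ hle)
        (Set.union_subset_union hKA hJ.subset)
      rw [hIJ, this]
      exact fun x hx => ⟨Or.inl hx, fun hxC => hK.2.ne_of_mem hxC hx rfl⟩
  have h1 : ((M ／ C).rk A : ℕ∞) = (I \ J).encard := by rw [coe_rk, hb.eRk_eq_encard]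
  have h2 : (M.rk C : ℕ∞) = J.encard := by rw [coe_rk, hJ.eRk_eq_encard]
  have h3 : (M.rk (A ∪ C) : ℕ∞) = I.encard := by rw [coe_rk, hI.eRk_eq_encard]
  have : ((M ／ C).rk A : ℕ∞) + M.rk C = M.rk (A ∪ C) := by
    rw [h1, h2, h3, Set.encard_sdiff_add_encard_of_subset hJI]
  exact_mod_cast this

theorem spanning_iff_rk (M : Matroid α) [M.RankFinite] (hX : X ⊆ M.E) :
    M.Spanning X ↔ M.rk X = M.rk M.E := by
  rw [spanning_iff_eRk_le hX, ← eRk_ground, ← coe_rk, ← coe_rk, Nat.cast_le]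
  have := M.rk_mono hX
  omega

theorem restrict_eq_restrict_of_rk [M.RankFinite] [N.RankFinite] (hS : S.Finite)
    (h : ∀ A ⊆ S, M.rk A = N.rk A) : M ↾ S = N ↾ S := by
  refine ext_indep rfl fun I hI => ?_
  rw [restrict_ground_eq] at hI
  rw [restrict_indep_iff, restrict_indep_iff, indep_iff_rk_eq_ncard _ (hS.subset hI),
    indep_iff_rk_eq_ncard _ (hS.subset hI), h I hI]

theorem rk_eq_of_restrict_eq (h : M ↾ S = N ↾ S) (hA : A ⊆ S) : M.rk A = N.rk A := by
  rw [← M.rk_restrict hA, h, N.rk_restrict hA]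

theorem contract_isMinor (M : Matroid α) (C : Set α) : M ／ C ≤m M := ⟨C, ∅, by simp⟩

theorem delete_isMinor (M : Matroid α) (D : Set α) : M ＼ D ≤m M := ⟨∅, D, by simp⟩

theorem IsMinor.matroidFinite [M.Finite] (h : N ≤m M) : N.Finite :=
  ⟨M.ground_finite.subset h.subset⟩

/-- If `X` is spanned by `Y` then it is spanned by every superset of `Y`. -/
theorem rk_union_eq_of_subset (M : Matroid α) [M.RankFinite] (h : M.rk (Y ∪ X) = M.rk Y)
    (hYZ : Y ⊆ Z) : M.rk (Z ∪ X) = M.rk Z := by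
  have h1 := M.rk_inter_add_rk_union_le Z (Y ∪ X)
  have h2 := M.rk_mono (Set.subset_inter hYZ (Set.subset_union_left (t := X)))
  have h3 : Z ∪ (Y ∪ X) = Z ∪ X := by
    rw [← Set.union_assoc, Set.union_eq_self_of_subset_right hYZ]
  have h4 := M.rk_mono (Set.subset_union_left (s := Z) (t := X))
  rw [h3] at h1
  omega

/-- Skewness passes to subsets. -/
theorem rk_union_eq_add_of_subset (M : Matroid α) [M.RankFinite]
    (h : M.rk (Y ∪ X) = M.rk Y + M.rk X) (hZY : Z ⊆ Y) : M.rk (Z ∪ X) = M.rk Z + M.rk X := by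
  have h1 := M.rk_inter_add_rk_union_le Y (Z ∪ X)
  have h2 := M.rk_mono (Set.subset_inter hZY (Set.subset_union_left (t := X)))
  have h3 : Y ∪ (Z ∪ X) = Y ∪ X := by
    rw [← Set.union_assoc, Set.union_eq_self_of_subset_right hZY]
  have h4 := M.rk_union_le Z X
  rw [h3] at h1
  omega

theorem lam_submod (M : Matroid α) [M.RankFinite] (X Y : Set α) :
    M.lam (X ∩ Y) + M.lam (X ∪ Y) ≤ M.lam X + M.lam Y := by
  have h1 := M.lam_add_rk X
  have h2 := M.lam_add_rk Y
  have h3 := M.lam_add_rk (X ∩ Y)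
  have h4 := M.lam_add_rk (X ∪ Y)
  have h5 := M.rk_inter_add_rk_union_le X Y
  have h6 := M.rk_inter_add_rk_union_le (M.E \ X) (M.E \ Y)
  rw [← Set.sdiff_inter, Set.sdiff_inter_sdiff] at h6
  omega

theorem lam_le_rk (M : Matroid α) [M.RankFinite] (X : Set α) : M.lam X ≤ M.rk X := by
  have h1 := M.lam_add_rk X
  have h2 := M.rk_mono (Set.sdiff_subset (s := M.E) (t := X))
  omega

/-- The local connectivity of sets on the two sides of a separation is at most its order. -/
theorem rk_add_rk_le_lam (M : Matroid α) [M.RankFinite] (hA : A ⊆ Z) (hB : B ⊆ M.E \ Z) :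
    M.rk A + M.rk B ≤ M.rk (A ∪ B) + M.lam Z := by
  have h0 := M.lam_add_rk Z
  have h1 := M.rk_inter_add_rk_union_le Z (A ∪ B)
  have h2 := M.rk_inter_add_rk_union_le (Z ∪ B) (M.E \ Z)
  have h3 : M.rk A ≤ M.rk (Z ∩ (A ∪ B)) :=
    M.rk_mono (Set.subset_inter hA Set.subset_union_left)
  have h4 : M.rk B ≤ M.rk ((Z ∪ B) ∩ (M.E \ Z)) :=
    M.rk_mono (Set.subset_inter Set.subset_union_right hB)
  have h5 : Z ∪ (A ∪ B) = Z ∪ B := by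
    rw [← Set.union_assoc, Set.union_eq_self_of_subset_right hA]
  have h6 : M.rk M.E ≤ M.rk (Z ∪ B ∪ (M.E \ Z)) := by
    refine M.rk_mono fun x hx => ?_
    by_cases hxZ : x ∈ Z
    · exact Or.inl (Or.inl hxZ)
    · exact Or.inr ⟨hx, hxZ⟩
  rw [h5] at h1
  omega

theorem lam_contract_le (M : Matroid α) [M.RankFinite] (C Z : Set α) :
    (M ／ C).lam (Z \ C) ≤ M.lam Z := by
  have h1 := M.lam_add_rk Z
  have h2 := (M ／ C).lam_add_rk (Z \ C)
  have h3 := M.rk_contract_add C (Z \ C)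
  have h4 := M.rk_contract_add C ((M ／ C).E \ (Z \ C))
  have h5 := M.rk_contract_add C (M ／ C).E
  have h6 := M.rk_inter_add_rk_union_le (Z ∪ (M.E ∩ C)) ((M.E \ Z) ∪ C)
  have h7 := M.rk_inter_add_rk_union_le Z C
  have h8 := M.rk_inter_add_rk_union_le (M.E \ Z) C
  have e1 : Z \ C ∪ C = Z ∪ C := Set.sdiff_union_self
  have e2 : (M ／ C).E \ (Z \ C) ∪ C = M.E \ Z ∪ C := by
    rw [contract_ground]; ext x; simp; tauto
  have e3 : (M ／ C).E ∪ C = M.E ∪ C := by rw [contract_ground, Set.sdiff_union_self]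
  have h9 : M.rk (M.E ∪ C) = M.rk M.E := by simp [rk]
  have h10 := M.rk_inter_add_rk_union_le (Z ∩ C) ((M.E \ Z) ∩ C)
  have e4 : M.rk (Z ∩ C ∪ M.E \ Z ∩ C) = M.rk C := by
    apply le_antisymm (M.rk_mono (by rintro x (hx | hx) <;> exact hx.2))
    rw [← M.rk_inter_ground C]
    exact M.rk_mono (by rintro x ⟨hx, hE⟩; by_cases hxZ : x ∈ Z <;> simp [*])
  rw [e1] at h3
  rw [e2] at h4
  rw [e3] at h5
  omega

theorem lam_delete_add (M : Matroid α) [M.RankFinite] (h : Disjoint A D) :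
    (M ＼ D).lam A + M.rk (M.E \ D) = M.rk A + M.rk ((M.E \ D) \ A) := by
  have h2 := (M ＼ D).lam_add_rk A
  rwa [delete_ground, M.rk_delete h, M.rk_delete Set.disjoint_sdiff_left,
    M.rk_delete ((Set.disjoint_sdiff_left (t := M.E)).mono_left Set.sdiff_subset)] at h2

theorem lam_delete_le (M : Matroid α) [M.RankFinite] (D Z : Set α) :
    (M ＼ D).lam (Z \ D) ≤ M.lam Z := by
  have h2 := M.lam_delete_add (Set.disjoint_sdiff_left (t := Z) (s := D))
  have h3 : (M.E \ D) \ (Z \ D) = (M.E \ D) \ Z := by ext x; simp; tauto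
  have h4 : M.rk ((M.E \ D) ∩ Z) ≤ M.rk (Z \ D) :=
    M.rk_mono (by rintro x ⟨⟨_, h⟩, h'⟩; exact ⟨h', h⟩)
  have h5 := M.rk_add_rk_le_lam (A := Z \ D) (B := (M.E \ D) \ Z) (Z := Z) Set.sdiff_subset
    (Set.sdiff_subset_sdiff_left Set.sdiff_subset)
  have h6 : M.rk (Z \ D ∪ (M.E \ D) \ Z) = M.rk (M.E \ D) := by
    rw [← M.rk_inter_ground (Z \ D ∪ _)]
    congr 1
    ext x; simp; tauto
  rw [h3] at h2
  omega

theorem IsMinor.lam_inter_le [M.RankFinite] (h : N ≤m M) (Z : Set α) :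
    N.lam (Z ∩ N.E) ≤ M.lam Z := by
  obtain ⟨C, D, rfl⟩ := h
  have h1 := M.lam_contract_le C Z
  have h2 := (M ／ C).lam_delete_le D (Z \ C)
  have h3 : ∀ (N : Matroid α) [N.RankFinite] (Y : Set α), N.lam (Y ∩ N.E) = N.lam Y := by
    intro N _ Y
    simp only [lam, rk_inter_ground, Set.sdiff_inter_self_eq_sdiff]
  have h4 : (Z ∩ (M ／ C ＼ D).E) = ((Z \ C) \ D) ∩ (M ／ C ＼ D).E := by
    simp only [delete_ground, contract_ground]; ext x; simp; tauto
  rw [h4, h3]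
  omega

theorem IsMinor.rk_le [M.RankFinite] (h : N ≤m M) (A : Set α) (hA : A ⊆ N.E) :
    N.rk A ≤ M.rk A := by
  obtain ⟨C, D, rfl⟩ := h
  rw [rk_delete _ (Set.subset_sdiff.1 hA).2]
  have := M.rk_contract_add C A
  have := M.rk_union_le A C
  omega

end Rank

/-! ### Tutte's Linking Theorem -/

section Linking

variable {α : Type*} {M : Matroid α} {A B S T : Set α} {e : α}

/-- The uncrossing inequality behind Tutte's Linking Theorem. -/
theorem lam_delete_add_lam_contract (M : Matroid α) [M.RankFinite] (he : e ∈ M.E) (heA : e ∉ A)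
    (heB : e ∉ B) (h1 : M.rk {e} = 1) :
    M.lam (A ∩ B) + M.lam (insert e (A ∪ B)) ≤ (M ＼ {e}).lam A + (M ／ {e}).lam B + 1 := by
  have k1 := M.lam_add_rk (A ∩ B)
  have k2 := M.lam_add_rk (insert e (A ∪ B))
  have k3 := M.lam_delete_add (Set.disjoint_singleton_right.2 heA)
  have k4 := (M ／ {e}).lam_add_rk B
  have c1 := M.rk_contract_add {e} B
  have c2 := M.rk_contract_add {e} ((M ／ {e}).E \ B)
  have c3 := M.rk_contract_add {e} (M ／ {e}).E
  rw [contract_ground] at c2 c3 k4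
  have e2 : (M.E \ {e}) \ B ∪ {e} = M.E \ B := by
    ext x
    by_cases hx : x = e
    · subst hx; simp [he, heB]
    · simp [hx]
  have e3 : M.E \ {e} ∪ {e} = M.E := by simp [he]
  rw [e2] at c2
  rw [e3] at c3
  have s1 := M.rk_inter_add_rk_union_le A (B ∪ {e})
  have s2 := M.rk_inter_add_rk_union_le ((M.E \ {e}) \ A) (M.E \ B)
  have f1 : A ∩ (B ∪ {e}) = A ∩ B := by
    ext x
    by_cases hx : x = e
    · subst hx; simp [heA]
    · simp [hx]
  have f2 : A ∪ (B ∪ {e}) = insert e (A ∪ B) := by ext x; simp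
  have f3 : (M.E \ {e}) \ A ∩ (M.E \ B) = M.E \ insert e (A ∪ B) := by ext x; simp; tauto
  have f4 : (M.E \ {e}) \ A ∪ (M.E \ B) = M.E \ (A ∩ B) := by
    ext x
    by_cases hx : x = e
    · subst hx; simp [heA, heB]
    · simp [hx]; tauto
  rw [f1, f2] at s1
  rw [f3, f4] at s2
  have m1 := M.rk_mono (Set.sdiff_subset (s := M.E) (t := {e}))
  omega

/-- An element `e` outside `S ∪ T` that is spanned by `S` or by `T` can be deleted. Any other `e` is
skew to both, so contracting it leaves both restrictions intact; if deletion fails at `A` and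
contraction fails at `B`, uncrossing makes `A ∩ B` or `A ∪ B ∪ {e}` violate the hypothesis in `M`.
-/
theorem exists_minor_linking (M : Matroid α) [M.Finite] (hS : S ⊆ M.E) (hT : T ⊆ M.E)
    (hST : Disjoint S T) (k : ℕ) (hk : ∀ A, S ⊆ A → A ⊆ M.E \ T → k ≤ M.lam A) :
    ∃ M' : Matroid α, M' ≤m M ∧ M'.E = S ∪ T ∧ M' ↾ S = M ↾ S ∧ M' ↾ T = M ↾ T ∧
      k ≤ M'.lam S := by
  induction hn : (M.E \ (S ∪ T)).ncard generalizing M with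
  | zero =>
    rw [Set.ncard_eq_zero M.ground_finite.sdiff, Set.sdiff_eq_empty] at hn
    exact ⟨M, IsMinor.refl, hn.antisymm (Set.union_subset hS hT), rfl, rfl,
      hk S subset_rfl (Set.subset_sdiff.2 ⟨hS, hST⟩)⟩
  | succ n ih =>
    obtain ⟨e, heE, heST⟩ := Set.nonempty_of_ncard_ne_zero (by omega : (M.E \ (S ∪ T)).ncard ≠ 0)
    have heS : e ∉ S := fun h => heST (Or.inl h)
    have heT : e ∉ T := fun h => heST (Or.inr h)
    have hcard : ((M.E \ {e}) \ (S ∪ T)).ncard = n := by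
      have hmem : e ∈ M.E \ (S ∪ T) := ⟨heE, heST⟩
      have := Set.ncard_sdiff_singleton_of_mem hmem
      rw [Set.sdiff_sdiff_comm, this, hn, Nat.add_sub_cancel]
    have hSe : S ⊆ M.E \ {e} := Set.subset_sdiff_singleton hS heS
    have hTe : T ⊆ M.E \ {e} := Set.subset_sdiff_singleton hT heT
    have hdel : (∀ A, S ⊆ A → A ⊆ (M.E \ {e}) \ T → k ≤ (M ＼ {e}).lam A) →
        ∃ M' : Matroid α, M' ≤m M ∧ M'.E = S ∪ T ∧ M' ↾ S = M ↾ S ∧ M' ↾ T = M ↾ T ∧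
          k ≤ M'.lam S := by
      intro h
      obtain ⟨M', hm, hE, hS', hT', hl⟩ := ih (M ＼ {e}) hSe hTe h hcard
      refine ⟨M', hm.trans (M.delete_isMinor {e}), hE, ?_, ?_, hl⟩
      · rw [hS', delete_eq_restrict, restrict_restrict_eq _ hSe]
      · rw [hT', delete_eq_restrict, restrict_restrict_eq _ hTe]
    have hlamdel : ∀ A ⊆ (M.E \ {e}) \ T, (M ＼ {e}).lam A + M.rk (M.E \ {e}) =
        M.rk A + M.rk ((M.E \ {e}) \ A) := by
      intro A hA
      exact M.lam_delete_add (Set.subset_sdiff.1 (hA.trans Set.sdiff_subset)).2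
    have hmono := M.rk_mono (Set.sdiff_subset (s := M.E) (t := {e}))
    by_cases hclS : M.rk (S ∪ {e}) = M.rk S
    · refine hdel fun A hSA hA => ?_
      have h1 := hk (A ∪ {e}) (hSA.trans Set.subset_union_left) (by
        refine Set.union_subset (hA.trans (Set.sdiff_subset_sdiff_left Set.sdiff_subset)) ?_
        simp [heE, heT])
      have h2 := M.lam_add_rk (A ∪ {e})
      have h3 := hlamdel A hA
      have h4 := M.rk_union_eq_of_subset hclS hSA
      have h5 : M.E \ (A ∪ {e}) = (M.E \ {e}) \ A := by
        rw [Set.sdiff_sdiff, Set.union_comm]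
      rw [h5] at h2
      omega
    by_cases hclT : M.rk (T ∪ {e}) = M.rk T
    · refine hdel fun A hSA hA => ?_
      have heA : e ∉ A := fun h => (hA h).1.2 rfl
      have h1 := hk A hSA (hA.trans (Set.sdiff_subset_sdiff_left Set.sdiff_subset))
      have h2 := M.lam_add_rk A
      have h3 := hlamdel A hA
      have h4 := M.rk_union_eq_of_subset (Z := (M.E \ {e}) \ A) hclT
        (Set.subset_sdiff.2 ⟨hTe, (Set.subset_sdiff.1 hA).2.symm⟩)
      have h5 : (M.E \ {e}) \ A ∪ {e} = M.E \ A := by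
        ext x
        by_cases hx : x = e
        · subst hx; simp [heE, heA]
        · simp [hx]
      rw [h5] at h4
      omega
    by_cases hd : ∀ A, S ⊆ A → A ⊆ (M.E \ {e}) \ T → k ≤ (M ＼ {e}).lam A
    · exact hdel hd
    push Not at hd
    obtain ⟨A, hSA, hA, hlt⟩ := hd
    have he1 := M.rk_singleton_le e
    have skewS : M.rk (S ∪ {e}) = M.rk S + M.rk {e} := by
      have := M.rk_union_le S {e}
      have := M.rk_mono (Set.subset_union_left (s := S) (t := {e}))
      omega
    have skewT : M.rk (T ∪ {e}) = M.rk T + M.rk {e} := by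
      have := M.rk_union_le T {e}
      have := M.rk_mono (Set.subset_union_left (s := T) (t := {e}))
      omega
    have he1' : M.rk {e} = 1 := by omega
    obtain ⟨M', hm, hE, hS', hT', hl⟩ := ih (M ／ {e}) hSe hTe (by
      intro B hSB hB
      have heA : e ∉ A := fun h => (hA h).1.2 rfl
      have heB : e ∉ B := fun h => (hB h).1.2 rfl
      have hA' : A ⊆ M.E \ T := hA.trans (Set.sdiff_subset_sdiff_left Set.sdiff_subset)
      have hB' : B ⊆ M.E \ T := hB.trans (Set.sdiff_subset_sdiff_left Set.sdiff_subset)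
      have h1 := M.lam_delete_add_lam_contract heE heA heB he1'
      have h2 := hk (A ∩ B) (Set.subset_inter hSA hSB) (Set.inter_subset_left.trans hA')
      have h3 := hk (insert e (A ∪ B)) ((hSA.trans Set.subset_union_left).trans
        (Set.subset_insert _ _)) (Set.insert_subset ⟨heE, heT⟩ (Set.union_subset hA' hB'))
      omega) hcard
    refine ⟨M', hm.trans (M.contract_isMinor {e}), hE, hS'.trans ?_, hT'.trans ?_, hl⟩
    · refine restrict_eq_restrict_of_rk (M.ground_finite.subset hS) fun A hA => ?_
      have := M.rk_contract_add {e} A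
      have := M.rk_union_eq_add_of_subset skewS hA
      omega
    · refine restrict_eq_restrict_of_rk (M.ground_finite.subset hT) fun A hA => ?_
      have := M.rk_contract_add {e} A
      have := M.rk_union_eq_add_of_subset skewT hA
      omega

end Linking

/-! ### Counting vectors over a finite field -/

section LinearAlgebra

open Module Submodule

variable {F V α : Type*} [Field F] [AddCommGroup V] [Module F V]

theorem ncard_submodule_eq_pow [Module.Finite F V] (U : Submodule F V) :
    (U : Set V).ncard = Nat.card F ^ finrank F U := by
  rw [← Module.natCard_eq_pow_finrank (K := F) (V := U)]
  rfl

/-- Linear counterpart of `rk_contract_add`: the quotient by the span of `T` represents the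
contraction of `T`. -/
theorem finrank_span_mkQ_add [Module.Finite F V] (v : α → V) (A T : Set α) :
    finrank F (span F ((fun x => (span F (v '' T)).mkQ (v x)) '' A)) + finrank F (span F (v '' T)) =
      finrank F (span F (v '' (A ∪ T))) := by
  set K := span F (v '' T)
  set P := span F (v '' (A ∪ T))
  have hKP : K ≤ P := span_mono (Set.image_mono Set.subset_union_right)
  have hP : P = span F (v '' A) ⊔ K := by
    rw [← span_union, ← Set.image_union]
  have h1 := LinearMap.finrank_range_add_finrank_ker (K.mkQ.domRestrict P)
  have h2 : LinearMap.range (K.mkQ.domRestrict P) =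
      span F ((fun x => K.mkQ (v x)) '' A) := by
    rw [LinearMap.range_domRestrict, hP, Submodule.map_sup, mkQ_map_self,
      sup_bot_eq, map_span, Set.image_image]
  have h3 : finrank F (LinearMap.ker (K.mkQ.domRestrict P)) = finrank F K := by
    rw [LinearMap.ker_domRestrict, ker_mkQ]
    exact (submoduleOfEquivOfLe hKP).finrank_eq
  rw [h2, h3] at h1
  exact h1

/-- The union of the lines spanned by the vectors `v y` with `y ∈ Y`. -/
def lineUnion (F : Type*) [Field F] [Module F V] (v : α → V) (Y : Set α) : Set V :=
  {x | ∃ c : F, ∃ y ∈ Y, x = c • v y}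

theorem lineUnion_subset_span (v : α → V) (Y : Set α) :
    lineUnion F v Y ⊆ span F (v '' Y) := by
  rintro _ ⟨c, y, hy, rfl⟩
  exact smul_mem _ _ (subset_span ⟨y, hy, rfl⟩)

/-- Nonzero, pairwise non-parallel vectors span lines that meet only in 0, and each line has q − 1
nonzero vectors. -/
theorem ncard_le_ncard_lineUnion [Finite F] [Module.Finite F V] {v : α → V} {Y : Set α}
    (hY : Y.Nonempty) (h0 : ∀ y ∈ Y, v y ≠ 0)
    (h1 : ∀ y ∈ Y, ∀ y' ∈ Y, ∀ c : F, v y = c • v y' → y = y') :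
    (Nat.card F - 1) * Y.ncard + 1 ≤ (lineUnion F v Y).ncard := by
  have : Finite V := Module.finite_of_finite F
  let g : Fˣ × Y → V := fun p => (p.1 : F) • v p.2
  have hg : Function.Injective g := by
    rintro ⟨c, y, hy⟩ ⟨c', y', hy'⟩ h
    replace h : (c : F) • v y = (c' : F) • v y' := h
    have hyy : y = y' := by
      refine h1 y hy y' hy' ((c : F)⁻¹ * c') ?_
      rw [mul_smul, ← h, inv_smul_smul₀ c.ne_zero]
    subst hyy
    have : c = c' := by
      ext
      exact smul_left_injective F (h0 y hy) h
    rw [this]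
  have hcard : (Set.range g).ncard = (Nat.card F - 1) * Y.ncard := by
    rw [← Set.image_univ, Set.ncard_image_of_injective _ hg, Set.ncard_univ, Nat.card_prod,
      Nat.card_units, Nat.card_coe_set_eq]
  have hsub : insert 0 (Set.range g) ⊆ lineUnion F v Y := by
    refine Set.insert_subset ?_ ?_
    · obtain ⟨y, hy⟩ := hY
      exact ⟨0, y, hy, by simp⟩
    · rintro _ ⟨⟨c, y, hy⟩, rfl⟩
      exact ⟨c, y, hy, rfl⟩
  rw [← hcard, ← Set.ncard_insert_of_notMem (a := (0 : V))]
  · exact Set.ncard_le_ncard hsub (Set.toFinite _)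
  · rintro ⟨⟨c, y, hy⟩, h⟩
    exact smul_ne_zero c.ne_zero (h0 y hy) h

/-- If translation by each multiple of the vectors `t i` moves few elements of `A` out of `A`, then
`A` contains many translates of the span of the `t i`. -/
theorem ncard_le_mul_ncard_translates [Finite F] [Finite V] {h : ℕ} (hh : 0 < h) (A : Set V)
    (t : Fin h → V)
    (hA : ∀ i (c : F), h * Nat.card F ^ h * {x ∈ A | x + c • t i ∉ A}.ncard ≤ A.ncard) :
    A.ncard ≤ Nat.card F ^ h * {x ∈ A | ∀ u ∈ span F (Set.range t), x + u ∈ A}.ncard := by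
  classical
  have : Fintype F := Fintype.ofFinite F
  set Q := Nat.card F ^ h
  -- The size of `bad u` is subadditive in `u`: if adding `u + w` leaves `A`, then so does adding
  -- `u`, or else adding `w` to `x + u`. Hence each of the q^h combinations moves at most |A|/q^h
  -- elements.
  let bad : V → Set V := fun u => {x ∈ A | x + u ∉ A}
  have hsub : ∀ u w, (bad (u + w)).ncard ≤ (bad u).ncard + (bad w).ncard := by
    intro u w
    have : bad (u + w) ⊆ bad u ∪ (fun x => x - u) '' bad w := by
      rintro x ⟨hx, hxu⟩
      by_cases h' : x + u ∈ A
      · exact Or.inr ⟨x + u, ⟨h', by rwa [add_assoc]⟩, by simp⟩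
      · exact Or.inl ⟨hx, h'⟩
    refine (Set.ncard_le_ncard this (Set.toFinite _)).trans ((Set.ncard_union_le _ _).trans ?_)
    exact Nat.add_le_add_left (Set.ncard_image_le (Set.toFinite _)) _
  have hsum : ∀ (c : Fin h → F) (s : Finset (Fin h)),
      h * Q * (bad (∑ i ∈ s, c i • t i)).ncard ≤ s.card * A.ncard := by
    intro c s
    induction s using Finset.induction_on with
    | empty => simp [bad]
    | insert i s hi ih =>
      rw [Finset.sum_insert hi, Finset.card_insert_of_notMem hi]
      calc _ ≤ h * Q * ((bad (c i • t i)).ncard + (bad (∑ i ∈ s, c i • t i)).ncard) :=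
            Nat.mul_le_mul_left _ (hsub _ _)
        _ ≤ A.ncard + s.card * A.ncard := by
            rw [mul_add]
            exact Nat.add_le_add (hA i (c i)) ih
        _ = _ := by ring
  have hone : ∀ c : Fin h → F, Q * (bad (∑ i, c i • t i)).ncard ≤ A.ncard := by
    intro c
    have := hsum c Finset.univ
    rw [Finset.card_univ, Fintype.card_fin, mul_assoc] at this
    exact Nat.le_of_mul_le_mul_left this hh
  set good := {x ∈ A | ∀ u ∈ span F (Set.range t), x + u ∈ A}
  -- The zero combination moves nothing, so only q^h − 1 bad sets need to be removed, which leaves a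
  -- q^(-h) fraction of `A`.
  have hcover : A ⊆ good ∪ ⋃ c ∈ (Finset.univ.erase (0 : Fin h → F)), bad (∑ i, c i • t i) := by
    intro x hx
    by_cases hg : x ∈ good
    · exact Or.inl hg
    · have : ∃ u ∈ span F (Set.range t), x + u ∉ A := by
        by_contra! hcon
        exact hg ⟨hx, hcon⟩
      obtain ⟨u, hu, hxu⟩ := this
      obtain ⟨c, rfl⟩ := (mem_span_range_iff_exists_fun F).1 hu
      refine Or.inr ?_
      simp only [Set.mem_iUnion]
      refine ⟨c, Finset.mem_erase.2 ⟨?_, Finset.mem_univ _⟩, hx, hxu⟩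
      rintro rfl
      simp [hx] at hxu
  have hle : A.ncard ≤ good.ncard +
      ∑ c ∈ (Finset.univ.erase (0 : Fin h → F)), (bad (∑ i, c i • t i)).ncard := by
    refine (Set.ncard_le_ncard hcover (Set.toFinite _)).trans ((Set.ncard_union_le _ _).trans ?_)
    exact Nat.add_le_add_left (Finset.set_ncard_biUnion_le _ _) _
  have hcardc : (Finset.univ.erase (0 : Fin h → F)).card = Q - 1 := by
    rw [Finset.card_erase_of_mem (Finset.mem_univ _), Finset.card_univ, Fintype.card_fun,
      Fintype.card_fin, ← Nat.card_eq_fintype_card]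
  have hbad : Q * ∑ c ∈ (Finset.univ.erase (0 : Fin h → F)), (bad (∑ i, c i • t i)).ncard ≤
      (Q - 1) * A.ncard := by
    rw [Finset.mul_sum, ← hcardc, ← smul_eq_mul]
    exact Finset.sum_le_card_nsmul _ _ _ fun c _ => hone c
  have hQ : 0 < Q := pow_pos Nat.card_pos _
  have h1 := Nat.mul_le_mul_left Q hle
  rw [mul_add] at h1
  obtain ⟨m, hm⟩ : ∃ m, Q = m + 1 := ⟨Q - 1, by omega⟩
  rw [hm] at h1 hbad ⊢
  simp only [Nat.add_sub_cancel] at hbad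
  have : (m + 1) * A.ncard = m * A.ncard + A.ncard := by ring
  omega

end LinearAlgebra

/-! ### Represented matroids and projective geometries in them -/

section Representation

open Module Submodule

variable {F V α β : Type*} [Field F] [AddCommGroup V] [Module F V] {v : α → V} {A E : Set α}

theorem rk_vectorMatroid [Module.Finite F V] (hA : A ⊆ E) :
    (vectorMatroid F v E).rk A = finrank F (span F (v '' A)) := by
  obtain ⟨I, hI⟩ := (vectorMatroid F v E).exists_isBasis' A
  have hli : LinearIndepOn F v I := hI.indep.2
  have hspan : span F (v '' A) = span F (v '' I) := by
    refine le_antisymm (span_le.2 ?_) (span_mono (Set.image_mono hI.subset))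
    rintro _ ⟨x, hx, rfl⟩
    by_contra hxI
    have hmem : x ∈ I := hI.mem_of_insert_indep hx
      ⟨Set.insert_subset (hA hx) hI.indep.1, hli.insert hxI⟩
    exact hxI (subset_span ⟨x, hmem, rfl⟩)
  have hfin : Finite I := hli.finite
  have : Fintype I := Fintype.ofFinite I
  have hcard := finrank_span_eq_card hli
  rw [← Set.image_eq_range] at hcard
  rw [rk, hI.eRk_eq_encard, hspan]
  exact (Set.ncard_eq_toFinset_card' I).trans ((Set.toFinset_card I).trans hcard.symm)

theorem finite_projGeom (F : Type*) [Field F] [Finite F] (h : ℕ) :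
    Finite (Projectivization F (Fin h → F)) :=
  (Projectivization.finite_iff_of_finite F _).2 inferInstance

/-- A set of elements of a represented matroid, one for each point of a subspace, induces a
projective geometry. -/
theorem isProjGeom_restrict [Finite F] [Module.Finite F V] (M : Matroid α) [M.RankFinite] {h : ℕ}
    (φ : (Fin h → F) →ₗ[F] V) (hφ : Function.Injective φ)
    (f : Projectivization F (Fin h → F) → α)
    (hf : ∀ p, ∃ c : F, c ≠ 0 ∧ φ p.rep = c • v (f p))
    (hv : ∀ A ⊆ Set.range f, M.rk A = finrank F (span F (v '' A))) :
    (M ↾ Set.range f).IsProjGeom F h := by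
  have := finite_projGeom F h
  have hinj : Function.Injective f := by
    intro p p' hpp
    obtain ⟨c, hc, h1⟩ := hf p
    obtain ⟨c', hc', h2⟩ := hf p'
    rw [← p.mk_rep, ← p'.mk_rep, Projectivization.mk_eq_mk_iff']
    refine ⟨c * c'⁻¹, hφ ?_⟩
    rw [map_smul, h1, h2, hpp, mul_smul, inv_smul_smul₀ hc']
  have hrk : ∀ I : Set (Projectivization F (Fin h → F)), M.rk (f '' I) = (projGeom F h).rk I := by
    intro I
    rw [hv _ (Set.image_subset_range f I), projGeom, rk_vectorMatroid (Set.subset_univ I)]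
    have : span F (v '' (f '' I)) = (span F ((fun x => x.rep) '' I)).map φ := by
      rw [map_span]
      refine le_antisymm (span_le.2 ?_) (span_le.2 ?_)
      · rintro _ ⟨_, ⟨p, hp, rfl⟩, rfl⟩
        obtain ⟨c, hc, h1⟩ := hf p
        have : v (f p) = c⁻¹ • φ p.rep := by rw [h1, inv_smul_smul₀ hc]
        rw [this]
        exact smul_mem _ _ (subset_span ⟨_, ⟨p, hp, rfl⟩, rfl⟩)
      · rintro _ ⟨_, ⟨p, hp, rfl⟩, rfl⟩
        obtain ⟨c, hc, h1⟩ := hf p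
        simp only [h1]
        exact smul_mem _ _ (subset_span ⟨_, ⟨p, hp, rfl⟩, rfl⟩)
    rw [this]
    exact (Submodule.equivMapOfInjective φ hφ _).finrank_eq.symm
  have : (projGeom F h).Finite := ⟨Set.toFinite _⟩
  refine ⟨f, hinj.injOn, ext_indep ?_ ?_⟩
  · simp [projGeom, vectorMatroid_ground]
  · intro J hJ
    obtain ⟨I, rfl⟩ := Set.subset_range_iff_exists_image_eq.1 hJ
    rw [map_image_indep_iff (Set.subset_univ I), restrict_indep_iff,
      indep_iff_rk_eq_ncard _ (Set.toFinite _), indep_iff_rk_eq_ncard _ (Set.toFinite _), hrk,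
      Set.ncard_image_of_injective _ hinj]
    simp

end Representation

/-! ### The expansion argument -/

section Expansion

open Module Submodule

/-- Bernoulli's inequality for (1 + 1/H)^m. It bounds the number of steps in which a set can grow by
the factor 1 + 1/H. -/
theorem pow_mul_succ_le_succ_pow {H Q m : ℕ} (hH : 0 < H) (hm : H * Q ≤ m) :
    H ^ m * (Q + 1) ≤ (H + 1) ^ m := by
  have hH' : (0 : ℝ) < H := by exact_mod_cast hH
  have h1 : (1 : ℝ) + m * (1 / H) ≤ (1 + 1 / H) ^ m :=
    one_add_mul_le_pow (by have : (0 : ℝ) < 1 / H := by positivity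
                           linarith) m
  have h2 : (Q : ℝ) + 1 ≤ 1 + m * (1 / H) := by
    have : (Q : ℝ) ≤ m * (1 / H) := by
      rw [mul_one_div, le_div_iff₀ hH', mul_comm]
      exact_mod_cast hm
    linarith
  have h3 : (H : ℝ) ^ m * (1 + 1 / H) ^ m = (H + 1) ^ m := by
    rw [← mul_pow]
    congr 1
    field_simp
  have h4 : (H : ℝ) ^ m * (Q + 1) ≤ (H + 1) ^ m := by
    rw [← h3]
    exact mul_le_mul_of_nonneg_left (h2.trans h1) (by positivity)
  exact_mod_cast h4

variable {F V α : Type*} [Field F] [AddCommGroup V] [Module F V] {v : α → V} {Y T T' : Set α}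

/-- The preimage of the union of lines of `Y` in the quotient by the span of `T`. -/
def lineSum (F : Type*) [Field F] [Module F V] (v : α → V) (Y T : Set α) : Set V :=
  {x | ∃ c : F, ∃ y ∈ Y, ∃ τ ∈ span F (v '' T), x = c • v y + τ}

theorem lineUnion_subset_lineSum : lineUnion F v Y ⊆ lineSum F v Y T := by
  rintro _ ⟨c, y, hy, rfl⟩
  exact ⟨c, y, hy, 0, zero_mem _, by simp⟩

theorem lineSum_mono (h : T ⊆ T') : lineSum F v Y T ⊆ lineSum F v Y T' := by
  rintro _ ⟨c, y, hy, τ, hτ, rfl⟩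
  exact ⟨c, y, hy, τ, span_mono (Set.image_mono h) hτ, rfl⟩

theorem lineSum_subset_span (hT : T ⊆ Y) : lineSum F v Y T ⊆ span F (v '' Y) := by
  rintro _ ⟨c, y, hy, τ, hτ, rfl⟩
  exact add_mem (smul_mem _ _ (subset_span ⟨y, hy, rfl⟩)) (span_mono (Set.image_mono hT) hτ)

theorem add_smul_mem_lineSum_insert {t : α} {x : V} (hx : x ∈ lineSum F v Y T) (c : F) :
    x + c • v t ∈ lineSum F v Y (insert t T) := by
  obtain ⟨d, y, hy, τ, hτ, rfl⟩ := hx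
  refine ⟨d, y, hy, τ + c • v t, ?_, by rw [add_assoc]⟩
  exact add_mem (span_mono (Set.image_mono (Set.subset_insert t T)) hτ)
    (smul_mem _ _ (subset_span ⟨t, Set.mem_insert t T, rfl⟩))

theorem smul_add_mem_lineSum {x τ : V} (hx : x ∈ lineSum F v Y T) (hτ : τ ∈ span F (v '' T))
    (c : F) : c • x + τ ∈ lineSum F v Y T := by
  obtain ⟨d, y, hy, σ, hσ, rfl⟩ := hx
  exact ⟨c * d, y, hy, c • σ + τ, add_mem (smul_mem _ _ hσ) hτ, by
    rw [smul_add, smul_smul, add_assoc]⟩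

variable [Finite F] [Module.Finite F V]

/-- If adding `t` to `T` does not enlarge `lineSum F v Y T` by much, then `lineSum F v Y T` is
almost invariant under translation by the multiples of `v t`. -/
theorem mul_ncard_moved_le {H : ℕ} (t : α)
    (hlt : H * (lineSum F v Y (insert t T)).ncard < (H + 1) * (lineSum F v Y T).ncard) (c : F) :
    H * {x ∈ lineSum F v Y T | x + c • v t ∉ lineSum F v Y T}.ncard ≤
      (lineSum F v Y T).ncard := by
  have : Finite V := Module.finite_of_finite F
  set A := lineSum F v Y T
  set A' := lineSum F v Y (insert t T)
  have hAA' : A ⊆ A' := lineSum_mono (Set.subset_insert t T)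
  -- The translation injects the moved elements into the growth `A' \ A`.
  have h1 : {x ∈ A | x + c • v t ∉ A}.ncard ≤ (A' \ A).ncard := by
    refine Set.ncard_le_ncard_of_injOn (fun x => x + c • v t) ?_ ?_ (Set.toFinite _)
    · rintro x ⟨hx, hxA⟩
      exact ⟨add_smul_mem_lineSum_insert hx c, hxA⟩
    · exact fun x _ y _ hxy => add_right_cancel hxy
  have h2 := Set.ncard_sdiff_add_ncard_of_subset hAA' (Set.toFinite _)
  have h3 := Nat.mul_le_mul_left H h1
  rw [← h2, mul_add, add_mul] at hlt
  omega

/-- The expansion argument: if `Y` is dense in its span, then for some small set `T ⊆ Y` skew to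
`X`, the image of `Y` in the quotient by `T` contains a translate, by one of its elements, of a
subspace of dimension `h`. -/
theorem exists_translate_of_dense (M : Matroid α) [M.Finite] {X Y : Set α} {h k : ℕ} (hh : 0 < h)
    (hE : M.E = X ∪ Y) (hXY : Disjoint X Y) (hlam : M.lam X = k)
    (hv : ∀ A ⊆ Y, M.rk A = finrank F (span F (v '' A)))
    (hdense : Nat.card F ^ M.rk Y < (Nat.card F ^ k + 1) * (lineUnion F v Y).ncard)
    (hrk : h * Nat.card F ^ (h + k) + 2 * h + 2 * k ≤ M.rk Y) :
    ∃ (T : Set α) (a : α) (t : Fin h → α), T ⊆ Y ∧ a ∈ Y ∧ Set.range t ⊆ Y ∧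
      T.ncard < h * Nat.card F ^ (h + k) ∧
      M.rk (X ∪ (insert a T ∪ Set.range t)) = M.rk X + (T.ncard + 1 + h) ∧
      ∀ u ∈ span F (Set.range fun i => v (t i)), v a + u ∈ lineSum F v Y T := by
  have : Finite V := Module.finite_of_finite F
  set q := Nat.card F with hq
  have hq2 : 2 ≤ q := Finite.one_lt_card
  set P := lineUnion F v Y with hPdef
  set H := h * q ^ h with hH
  have hHpos : 0 < H := Nat.mul_pos hh (pow_pos (by omega) _)
  have hXE : X ⊆ M.E := by rw [hE]; exact Set.subset_union_left
  have hYE : Y ⊆ M.E := by rw [hE]; exact Set.subset_union_right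
  have hEX : M.E \ X = Y := by
    rw [hE, Set.union_sdiff_left, hXY.symm.sdiff_eq_left]
  have hYfin : Y.Finite := M.ground_finite.subset hYE
  -- the set to be contracted
  let s : Set (Set α) := {T | T ⊆ Y ∧ M.rk (X ∪ T) = M.rk X + T.ncard ∧
    (H + 1) ^ T.ncard * P.ncard ≤ H ^ T.ncard * (lineSum F v Y T).ncard}
  have hsfin : s.Finite := hYfin.finite_subsets.subset fun T hT => hT.1
  have hsne : s.Nonempty := ⟨∅, Set.empty_subset _, by simp, by
    simpa using Set.ncard_le_ncard lineUnion_subset_lineSum (Set.toFinite _)⟩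
  -- Maximality means that no further element keeping `T` independent and skew to `X` enlarges the
  -- line sum by the factor 1 + 1/H.
  obtain ⟨T, ⟨hTY, hTrk, hTcard⟩, hTmax⟩ := hsfin.exists_maximal hsne
  have hTfin : T.Finite := hYfin.subset hTY
  set A := lineSum F v Y T with hA
  have hPpos : 0 < P.ncard := by
    by_contra h0
    rw [Nat.eq_zero_of_not_pos h0] at hdense
    simp at hdense
  have hPA : P.ncard ≤ A.ncard := Set.ncard_le_ncard lineUnion_subset_lineSum (Set.toFinite _)
  -- After H q^k growth steps the line sum would have at least (q^k + 1)|P| elements, more than the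
  -- span of `Y`.
  have hTL : T.ncard < h * q ^ (h + k) := by
    by_contra! hcon
    rw [pow_add, ← mul_assoc] at hcon
    have h1 := pow_mul_succ_le_succ_pow hHpos hcon
    have h2 : A.ncard ≤ q ^ M.rk Y := by
      rw [hv Y subset_rfl, ← ncard_submodule_eq_pow]
      exact Set.ncard_le_ncard (lineSum_subset_span hTY) (Set.toFinite _)
    have h3 : H ^ T.ncard * A.ncard < H ^ T.ncard * ((q ^ k + 1) * P.ncard) :=
      Nat.mul_lt_mul_of_pos_left (h2.trans_lt hdense) (pow_pos hHpos _)
    have h4 := Nat.mul_le_mul_right P.ncard h1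
    rw [mul_assoc] at h4
    omega
  have hgrow : ∀ t ∈ Y, M.rk (X ∪ insert t T) = M.rk X + (T.ncard + 1) →
      H * (lineSum F v Y (insert t T)).ncard < (H + 1) * A.ncard := by
    intro t ht htrk
    by_contra! hcon
    have htT : t ∉ T := by
      intro h'
      rw [Set.insert_eq_of_mem h', hTrk] at htrk
      omega
    have hn : (insert t T).ncard = T.ncard + 1 := Set.ncard_insert_of_notMem htT hTfin
    refine htT (hTmax ⟨Set.insert_subset ht hTY, by rw [htrk, hn], ?_⟩ (Set.subset_insert t T)
      (Set.mem_insert t T))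
    rw [hn]
    calc (H + 1) ^ (T.ncard + 1) * P.ncard = (H + 1) * ((H + 1) ^ T.ncard * P.ncard) := by ring
      _ ≤ (H + 1) * (H ^ T.ncard * A.ncard) := Nat.mul_le_mul_left _ hTcard
      _ = H ^ T.ncard * ((H + 1) * A.ncard) := by ring
      _ ≤ H ^ T.ncard * (H * (lineSum F v Y (insert t T)).ncard) := Nat.mul_le_mul_left _ hcon
      _ = _ := by ring
  -- the basis of the subspace
  have hlam' := M.lam_add_rk X
  rw [hEX, hlam] at hlam'
  -- Contracting `X ∪ T` leaves rank r(Y) − k − |T|, which is at least h.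
  obtain ⟨J, hJY, hJi, hJcard⟩ : ∃ J ⊆ Y, (M ／ (X ∪ T)).Indep J ∧ J.encard = h := by
    rw [← le_eRk_iff, ← coe_rk, Nat.cast_le]
    have h1 := M.rk_contract_add (X ∪ T) Y
    have h2 : Y ∪ (X ∪ T) = M.E := by
      rw [hE, Set.union_comm X T, ← Set.union_assoc, Set.union_eq_self_of_subset_right hTY,
        Set.union_comm]
    rw [h2] at h1
    omega
  have hJfin : J.Finite := hYfin.subset hJY
  have hJn : J.ncard = h := by rw [Set.ncard, hJcard]; rfl
  have hJrk : ∀ J' ⊆ J, M.rk (X ∪ (T ∪ J')) = M.rk X + (T.ncard + J'.ncard) := by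
    intro J' hJ'
    have h1 := M.rk_contract_add (X ∪ T) J'
    have h2 := (indep_iff_rk_eq_ncard _ (hJfin.subset hJ')).1 (hJi.subset hJ')
    rw [Set.union_comm J', Set.union_assoc] at h1
    omega
  have : Finite J := hJfin
  let e : Fin h ≃ J := (Finite.equivFinOfCardEq hJn).symm
  let t : Fin h → α := fun i => e i
  have ht : Set.range t = J := by
    rw [← Subtype.range_coe (s := J), ← e.surjective.range_comp]
    rfl
  have hmoved := ncard_le_mul_ncard_translates (F := F) hh A (fun i => v (t i)) (by
    intro i c
    refine mul_ncard_moved_le (t i) (hgrow _ (hJY (e i).2) ?_) c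
    have := hJrk {t i} (by rw [Set.singleton_subset_iff]; exact (e i).2)
    rwa [Set.ncard_singleton, Set.union_singleton] at this)
  set good := {x ∈ A | ∀ u ∈ span F (Set.range fun i => v (t i)), x + u ∈ A}
  -- the elements that must not be contracted
  set B := M.closure (X ∪ (T ∪ J)) ∩ Y with hB
  -- Since λ(X) = k, the rank of `B` exceeds that of the closure modulo `X` by at most k.
  have hBrk : M.rk B ≤ T.ncard + h + k := by
    have h1 := M.rk_add_rk_le_lam (A := X) (B := B) (Z := X) subset_rfl
      (by rw [hEX]; exact Set.inter_subset_right)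
    have h2 : M.rk (X ∪ B) ≤ M.rk (M.closure (X ∪ (T ∪ J))) := by
      refine M.rk_mono (Set.union_subset ?_ Set.inter_subset_left)
      exact Set.subset_union_left.trans (M.subset_closure _ (Set.union_subset hXE
        (Set.union_subset (hTY.trans hYE) (hJY.trans hYE))))
    have h3 : M.rk (M.closure (X ∪ (T ∪ J))) = M.rk (X ∪ (T ∪ J)) := by
      rw [rk, eRk_closure_eq, rk]
    have h4 := hJrk J subset_rfl
    omega
  have hTB : T ⊆ B := Set.subset_inter ((Set.subset_union_left.trans
    Set.subset_union_right).trans (M.subset_closure _ (Set.union_subset hXE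
        (Set.union_subset (hTY.trans hYE) (hJY.trans hYE))))) hTY
  -- `good` has at least |P|/q^h elements, too many for a space of dimension |T| + h + k.
  obtain ⟨x, hxgood, hxB⟩ : ∃ x ∈ good, x ∉ span F (v '' B) := by
    by_contra! hcon
    have h1 : good.ncard ≤ q ^ (T.ncard + h + k) := by
      refine (Set.ncard_le_ncard hcon (Set.toFinite _)).trans ?_
      rw [ncard_submodule_eq_pow, ← hv B Set.inter_subset_right]
      exact Nat.pow_le_pow_right (by omega) hBrk
    have h2 : P.ncard ≤ q ^ (T.ncard + 2 * h + k) := by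
      refine hPA.trans (hmoved.trans ((Nat.mul_le_mul_left _ h1).trans (le_of_eq ?_)))
      rw [← pow_add]
      congr 1
      omega
    have h3 : (q ^ k + 1) * P.ncard ≤ q ^ (k + 1) * q ^ (T.ncard + 2 * h + k) := by
      refine Nat.mul_le_mul ?_ h2
      have : 0 < q ^ k := pow_pos (by omega) _
      rw [pow_succ]
      nlinarith
    rw [← pow_add] at h3
    have h4 := Nat.pow_le_pow_right (n := q) (by omega)
      (show k + 1 + (T.ncard + 2 * h + k) ≤ M.rk Y by omega)
    omega
  obtain ⟨⟨c, a, haY, τ, hτ, rfl⟩, hxu⟩ := hxgood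
  have hτB : τ ∈ span F (v '' B) := span_mono (Set.image_mono hTB) hτ
  have hc : c ≠ 0 := by
    rintro rfl
    exact hxB (by simpa using hτB)
  have haB : a ∉ M.closure (X ∪ (T ∪ J)) := fun h' =>
    hxB (add_mem (smul_mem _ _ (subset_span ⟨a, ⟨h', haY⟩, rfl⟩)) hτB)
  refine ⟨T, a, t, hTY, haY, ht ▸ hJY, hTL, ?_, ?_⟩
  · have h1 : X ∪ (insert a T ∪ Set.range t) = insert a (X ∪ (T ∪ J)) := by
      rw [ht, Set.insert_union, Set.union_insert]
    have h2 := M.eRk_insert_eq_add_one ⟨hYE haY, haB⟩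
    rw [← coe_rk, ← coe_rk, hJrk J subset_rfl] at h2
    rw [h1]
    have h3 : M.rk (insert a (X ∪ (T ∪ J))) = M.rk X + (T.ncard + J.ncard) + 1 := by
      exact_mod_cast h2
    omega
  · intro u hu
    -- The line sum is closed under scaling and under adding the span of `T`, so the base point c
    -- v(a) + τ can be normalised to v(a).
    have h1 := smul_add_mem_lineSum (hxu (c • u) (smul_mem _ _ hu)) (smul_mem _ (-c⁻¹) hτ) c⁻¹
    have h2 : c⁻¹ • (c • v a + τ + c • u) + -c⁻¹ • τ = v a + u := by
      rw [smul_add, smul_add, inv_smul_smul₀ hc, inv_smul_smul₀ hc, neg_smul]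
      abel
    rwa [h2] at h1

end Expansion

/-! ### From a dense set to a projective geometry linked to X -/

section Dense

open Module Submodule

variable {F V α : Type*} [Field F] [AddCommGroup V] [Module F V] {v : α → V}
  [Finite F] [Module.Finite F V]

theorem pow_add_one_le_pow_succ {q : ℕ} (hq : 2 ≤ q) (k : ℕ) : q ^ k + 1 ≤ q ^ (k + 1) := by
  have h1 : 0 < q ^ k := pow_pos (by omega) _
  have h2 := Nat.mul_le_mul_left (q ^ k) hq
  rw [pow_succ]
  omega

/-- In the contraction of a small set `T` skew to `X`, no separation of order less than `k` divides
`X` from a set `W` of rank at least `k`, provided that `Y` is dense and robustly spanning. -/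
theorem le_lam_contract_of_dense (M : Matroid α) [M.Finite] {X Y T' W A : Set α} {h k l : ℕ}
    (hkh : k ≤ h) (hE : M.E = X ∪ Y) (hXY : Disjoint X Y) (hlam : M.lam X = k)
    (hv : ∀ A ⊆ Y, M.rk A = finrank F (span F (v '' A)))
    (hdense : Nat.card F ^ M.rk Y < (Nat.card F ^ k + 1) * (lineUnion F v Y).ncard)
    (hrobust : ∀ Y₁ ⊆ Y, M.rk Y₁ ≤ l + 2 * k → M.rk (Y \ Y₁) = M.rk Y)
    (hT'Y : T' ⊆ Y) (hXT' : M.rk (X ∪ T') = M.rk X + M.rk T') (hT'L : M.rk T' ≤ l)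
    (hWM₁ : W ⊆ (M ／ T').E) (hWrk : h ≤ (M ／ T').rk W) (hXA : X ⊆ A)
    (hA : A ⊆ (M ／ T').E \ W) : k ≤ (M ／ T').lam A := by
  have : Finite V := Module.finite_of_finite F
  set q := Nat.card F with hq
  have hq2 : 2 ≤ q := Finite.one_lt_card
  have hYE : Y ⊆ M.E := by rw [hE]; exact Set.subset_union_right
  have hEX : M.E \ X = Y := by
    rw [hE, Set.union_sdiff_left, hXY.symm.sdiff_eq_left]
  have hlam' := M.lam_add_rk X
  rw [hEX, hlam] at hlam'
  set M₁ := M ／ T' with hM₁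
  have hM₁E : M₁.E = M.E \ T' := rfl
  have hc := M.rk_contract_add T'
  rw [← hM₁] at hc
  by_contra! hlt
  have hAE : A ⊆ M₁.E := hA.trans Set.sdiff_subset
  set Y₁ := A ∩ Y with hY₁
  set Y₂ := M₁.E \ A with hY₂
  have hY₂Y : Y₂ ⊆ Y := by
    rw [← hEX]
    exact Set.sdiff_subset_sdiff (M.contract_ground_subset_ground T') hXA
  have hWY₂ : W ⊆ Y₂ := Set.subset_sdiff.2 ⟨hWM₁, (Set.subset_sdiff.1 hA).2.symm⟩
  have hY₁U : Y₁ ∪ T' ⊆ Y := Set.union_subset Set.inter_subset_right hT'Y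
  have hY₂U : Y₂ ∪ T' ⊆ Y := Set.union_subset hY₂Y hT'Y
  have hcov : ∀ y ∈ Y, y ∈ Y₁ ∪ T' ∨ y ∈ Y₂ ∪ T' := by
    intro y hy
    by_cases hyT : y ∈ T'
    · exact Or.inl (Or.inr hyT)
    by_cases hyA : y ∈ A
    · exact Or.inl (Or.inl ⟨hyA, hy⟩)
    · exact Or.inr (Or.inl ⟨⟨hYE hy, hyT⟩, hyA⟩)
  have l0 := M₁.lam_add_rk A
  rw [← hY₂] at l0
  have l1 := hc A
  have l2 := hc Y₂
  have l3 := hc M₁.E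
  have l4 : M.rk (M₁.E ∪ T') = M.rk M.E := by
    rw [hM₁E, Set.sdiff_union_of_subset (hT'Y.trans hYE)]
  have l5 := M₁.rk_add_rk_le_lam (A := Y₁) (B := Y₂) (Z := A) Set.inter_subset_left subset_rfl
  have l6 := hc Y₁
  have l7 := hc (Y₁ ∪ Y₂)
  have l8 : M.rk (Y₁ ∪ Y₂ ∪ T') ≤ M.rk Y := M.rk_mono
    (Set.union_subset (Set.union_subset Set.inter_subset_right hY₂Y) hT'Y)
  -- The lines of `Y` lie in the union of two subspaces. If both had rank at most r(Y) − k − 2, then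
  -- multiplying by q^k + 1 ≤ q^(k+1) would give at most 2q^(r(Y)−1) ≤ q^r(Y), against density.
  have hbig : M.rk Y ≤ M.rk (Y₁ ∪ T') + k + 1 ∨ M.rk Y ≤ M.rk (Y₂ ∪ T') + k + 1 := by
    by_contra! hcon
    have hsub : lineUnion F v Y ⊆
        (span F (v '' (Y₁ ∪ T')) : Set V) ∪ span F (v '' (Y₂ ∪ T')) := by
      rintro _ ⟨c, y, hy, rfl⟩
      rcases hcov y hy with h' | h'
      · exact Or.inl (smul_mem _ _ (subset_span ⟨y, h', rfl⟩))
      · exact Or.inr (smul_mem _ _ (subset_span ⟨y, h', rfl⟩))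
    have hcard := (Set.ncard_le_ncard hsub (Set.toFinite _)).trans (Set.ncard_union_le _ _)
    rw [ncard_submodule_eq_pow, ncard_submodule_eq_pow, ← hv _ hY₁U, ← hv _ hY₂U, ← hq] at hcard
    have hk1 := pow_add_one_le_pow_succ hq2 k
    have p1 : q ^ (k + 1) * q ^ M.rk (Y₁ ∪ T') ≤ q ^ (M.rk Y - 1) := by
      rw [← pow_add]
      exact Nat.pow_le_pow_right (by omega) (by omega)
    have p2 : q ^ (k + 1) * q ^ M.rk (Y₂ ∪ T') ≤ q ^ (M.rk Y - 1) := by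
      rw [← pow_add]
      exact Nat.pow_le_pow_right (by omega) (by omega)
    have p3 : q ^ M.rk Y = q * q ^ (M.rk Y - 1) := by
      rw [← pow_succ']
      congr 1
      omega
    have p4 := Nat.mul_le_mul hk1 hcard
    have p5 := Nat.mul_le_mul_right (q ^ (M.rk Y - 1)) hq2
    rw [mul_add] at p4
    omega
  rcases hbig with hb | hb
  -- The separation has order below k, so the other side has rank at most l + 2k and robustness
  -- applies. Hence `A` spans the contraction and λ(A) is the rank of `Y₂ ⊇ W`, at least h.
  · have hr := hrobust _ hY₂U (by omega)
    have hs : M.rk (Y₁ ∪ T' ∪ Y) = M.rk (Y₁ ∪ T') := by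
      rw [Set.union_eq_self_of_subset_left hY₁U]
      refine le_antisymm ?_ (M.rk_mono hY₁U)
      rw [← hr]
      exact M.rk_mono fun y hy => (hcov y hy.1).resolve_right hy.2
    have hs' := M.rk_union_eq_of_subset (Z := A ∪ T') hs
      (Set.union_subset_union_left _ Set.inter_subset_left)
    have hs'' : M.rk M.E ≤ M.rk (A ∪ T' ∪ Y) := by
      rw [hE]
      exact M.rk_mono (Set.union_subset_union_left _ (hXA.trans Set.subset_union_left))
    have hw := M₁.rk_mono hWY₂
    omega
  -- Now `Y₂ ∪ T'` spans `Y`; as `X` is skew to `T'`, λ(A) is at least r(X) + r(Y) − r(M) = k.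
  · have hr := hrobust _ hY₁U (by omega)
    have hs : M.rk Y ≤ M.rk (Y₂ ∪ T') := by
      rw [← hr]
      exact M.rk_mono fun y hy => (hcov y hy.1).resolve_left hy.2
    have hs' := M.rk_mono (Set.union_subset_union_left T' hXA)
    omega

/-- A matroid on `X ∪ Y` in which `Y` is represented, dense and robustly spanning has a minor in
which `Y` is replaced by a projective geometry, without changing the connectivity of `X`. -/
theorem exists_projGeom_minor_of_dense (M : Matroid α) [M.Finite] {X Y : Set α} {h k : ℕ}
    (hh : 0 < h) (hkh : k ≤ h) (hE : M.E = X ∪ Y) (hXY : Disjoint X Y) (hlam : M.lam X = k)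
    (hv : ∀ A ⊆ Y, M.rk A = finrank F (span F (v '' A)))
    (hdense : Nat.card F ^ M.rk Y < (Nat.card F ^ k + 1) * (lineUnion F v Y).ncard)
    (hrk : h * Nat.card F ^ (h + k) + 2 * h + 2 * k ≤ M.rk Y)
    (hrobust : ∀ Y₁ ⊆ Y, M.rk Y₁ ≤ h * Nat.card F ^ (h + k) + 2 * k → M.rk (Y \ Y₁) = M.rk Y) :
    ∃ M' N' : Matroid α, M' ≤m M ∧ N' ≤r M' ∧ N'.IsProjGeom F h ∧
      M'.E = N'.E ∪ X ∧ M' ↾ X = M ↾ X ∧ M'.lam X = k := by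
  have : Finite V := Module.finite_of_finite F
  obtain ⟨T, a, t, hTY, haY, htY, hTL, hfull, htrans⟩ :=
    exists_translate_of_dense M hh hE hXY hlam hv hdense hrk
  set q := Nat.card F with hq
  have hq2 : 2 ≤ q := Finite.one_lt_card
  set L := h * q ^ (h + k)
  have hXE : X ⊆ M.E := by rw [hE]; exact Set.subset_union_left
  have hYE : Y ⊆ M.E := by rw [hE]; exact Set.subset_union_right
  have hEX : M.E \ X = Y := by
    rw [hE, Set.union_sdiff_left, hXY.symm.sdiff_eq_left]
  have hYfin : Y.Finite := M.ground_finite.subset hYE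
  have hTfin : T.Finite := hYfin.subset hTY
  set T' := insert a T with hT'
  have hT'Y : T' ⊆ Y := Set.insert_subset haY hTY
  have hlam' := M.lam_add_rk X
  rw [hEX, hlam] at hlam'
  -- ranks of the contracted set and of the basis
  have hT'le : M.rk T' ≤ T.ncard + 1 :=
    (M.rk_le_ncard (hTfin.insert a)).trans (Set.ncard_insert_le a T)
  have htle : M.rk (Set.range t) ≤ h := by
    refine (M.rk_le_ncard (Set.finite_range t)).trans ?_
    rw [← Set.image_univ]
    refine (Set.ncard_image_le (Set.toFinite _)).trans ?_
    rw [Set.ncard_univ, Nat.card_fin]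
  -- `hfull` attains the trivial upper bound on the rank, so all these subadditivity inequalities
  -- are equalities.
  have u1 := M.rk_union_le X (T' ∪ Set.range t)
  have u2 := M.rk_union_le T' (Set.range t)
  have u3 := M.rk_union_le (X ∪ T') (Set.range t)
  rw [Set.union_assoc] at u3
  have u4 := M.rk_union_le X T'
  have hT'rk : M.rk T' = T.ncard + 1 := by omega
  have hXT' : M.rk (X ∪ T') = M.rk X + M.rk T' := by omega
  have hT't : M.rk (T' ∪ Set.range t) = M.rk T' + h := by omega
  set M₁ := M ／ T' with hM₁
  have hM₁E : M₁.E = M.E \ T' := rfl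
  have hc := M.rk_contract_add T'
  rw [← hM₁] at hc
  -- the representation of the contraction
  set K := span F (v '' T') with hK
  let v' : α → V ⧸ K := fun x => K.mkQ (v x)
  have hv' : ∀ A ⊆ Y, M₁.rk A = finrank F (span F (v' '' A)) := by
    intro A hA
    have h1 := hc A
    have h2 := finrank_span_mkQ_add (F := F) v A T'
    rw [← hv T' hT'Y, ← hv (A ∪ T') (Set.union_subset hA hT'Y)] at h2
    change finrank F (span F (v' '' A)) + _ = _ at h2
    omega
  have hK0 : ∀ x ∈ K, K.mkQ x = 0 := fun x hx => by simpa using hx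
  let φ : (Fin h → F) →ₗ[F] V ⧸ K := Fintype.linearCombination F fun i => v' (t i)
  have hφ : Function.Injective φ := by
    have hli : LinearIndependent F fun i => v' (t i) := by
      rw [linearIndependent_iff_card_eq_finrank_span, Fintype.card_fin, Set.finrank]
      have h1 := hv' (Set.range t) htY
      have h2 := hc (Set.range t)
      rw [← Set.range_comp] at h1
      change M₁.rk _ = finrank F (span F (Set.range fun i => v' (t i))) at h1
      rw [Set.union_comm] at h2
      omega
    exact hli.fintypeLinearCombination_injective
  -- Modulo `K` both v(a) and the span of `T` vanish, so v(a) + u = c v(y) + τ says that u is a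
  -- multiple of the image of y.
  have hpt : ∀ p : Projectivization F (Fin h → F), ∃ y ∈ Y, ∃ c : F, c ≠ 0 ∧
      φ p.rep = c • v' y := by
    intro p
    obtain ⟨c, y, hy, τ, hτ, heq⟩ := htrans (∑ i, p.rep i • v (t i))
      (sum_mem fun i _ => smul_mem _ _ (subset_span ⟨i, rfl⟩))
    have hval : φ p.rep = c • v' y := by
      have h1 : φ p.rep = K.mkQ (∑ i, p.rep i • v (t i)) := by
        simp only [map_sum, map_smul]
        rfl
      have h2 : ∑ i, p.rep i • v (t i) = c • v y + (τ - v a) := by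
        rw [eq_sub_of_add_eq' heq]
        abel
      rw [h1, h2, map_add, map_smul, hK0 (τ - v a), add_zero]
      exact sub_mem (span_mono (Set.image_mono (Set.subset_insert a T)) hτ)
        (subset_span ⟨a, Set.mem_insert a T, rfl⟩)
    refine ⟨y, hy, c, ?_, hval⟩
    rintro rfl
    rw [zero_smul, ← map_zero φ] at hval
    exact p.rep_nonzero (hφ hval)
  choose f hfY hfc using hpt
  set W := Set.range f with hW
  have hWY : W ⊆ Y := Set.range_subset_iff.2 hfY
  have hWT' : Disjoint W T' := by
    rw [Set.disjoint_left]
    rintro _ ⟨p, rfl⟩ hp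
    obtain ⟨c, hc, h1⟩ := hfc p
    have : v' (f p) = 0 := hK0 _ (subset_span ⟨_, hp, rfl⟩)
    rw [this, smul_zero, ← map_zero φ] at h1
    exact p.rep_nonzero (hφ h1)
  have hPG : (M₁ ↾ W).IsProjGeom F h :=
    isProjGeom_restrict M₁ φ hφ f hfc fun A hA => hv' A (hA.trans hWY)
  have hWrk : h ≤ M₁.rk W := by
    rw [hv' W hWY]
    have h1 : LinearMap.range φ ≤ span F (v' '' W) := by
      rintro _ ⟨x, rfl⟩
      by_cases hx : x = 0
      · simp [hx]
      obtain ⟨b, hb⟩ := Projectivization.exists_smul_eq_mk_rep F x hx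
      obtain ⟨c, hc, h1⟩ := hfc (Projectivization.mk F x hx)
      have : x = b⁻¹ • (Projectivization.mk F x hx).rep := by rw [← hb, inv_smul_smul]
      rw [this, Units.smul_def, map_smul, h1]
      exact smul_mem _ _ (smul_mem _ _ (subset_span ⟨_, ⟨_, rfl⟩, rfl⟩))
    have h2 := Submodule.finrank_mono h1
    rw [LinearMap.finrank_range_of_inj hφ, Module.finrank_fin_fun] at h2
    exact h2
  have hXT'd : Disjoint X T' := hXY.mono_right hT'Y
  have hXM₁ : X ⊆ M₁.E := Set.subset_sdiff.2 ⟨hXE, hXT'd⟩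
  have hWM₁ : W ⊆ M₁.E := Set.subset_sdiff.2 ⟨hWY.trans hYE, hWT'⟩
  have hXW : Disjoint X W := hXY.mono_right hWY
  have hconn : ∀ A, X ⊆ A → A ⊆ M₁.E \ W → k ≤ M₁.lam A := fun A hXA hA =>
    le_lam_contract_of_dense M hkh hE hXY hlam hv hdense hrobust hT'Y hXT' (by omega) hWM₁ hWrk
      hXA hA
  obtain ⟨M', hm, hE', hX', hW', hl⟩ := exists_minor_linking M₁ hXM₁ hWM₁ hXW k hconn
  have hmM : M' ≤m M := hm.trans (M.contract_isMinor T')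
  refine ⟨M', M' ↾ W, hmM, M'.restrict_isRestriction W (by rw [hE']; exact Set.subset_union_right),
    by rwa [hW'], by rw [hE', restrict_ground_eq, Set.union_comm], hX'.trans ?_, ?_⟩
  · refine restrict_eq_restrict_of_rk (M.ground_finite.subset hXE) fun A hA => ?_
    have h1 := hc A
    have h2 := M.rk_union_eq_add_of_subset hXT' hA
    omega
  · have h1 := hmM.lam_inter_le X
    rw [Set.inter_eq_self_of_subset_left (by rw [hE']; exact Set.subset_union_left)] at h1
    omega

end Dense

/-! ### Point counts and separations in projective geometries -/

section ProjGeom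

open Module Submodule

variable {F α : Type*} [Field F] {N : Matroid α} {n : ℕ} {A : Set α}

theorem IsProjGeom.exists_rk_eq (hN : N.IsProjGeom F n) (hA : A ⊆ N.E) :
    ∃ I : Set (Projectivization F (Fin n → F)), A.ncard = I.ncard ∧
      N.rk A = finrank F (span F ((fun p => p.rep) '' I)) := by
  obtain ⟨f, hf, rfl⟩ := hN
  obtain ⟨I, hI, rfl⟩ := Set.subset_image_iff.1 hA
  refine ⟨I, (hf.mono hI).ncard_image, ?_⟩
  rw [rk, eRk_map _ hf hI]
  exact rk_vectorMatroid (Set.subset_univ I)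

variable [Finite F]

theorem IsProjGeom.matroidFinite (hN : N.IsProjGeom F n) : N.Finite := by
  obtain ⟨f, hf, rfl⟩ := hN
  have := finite_projGeom F n
  exact ⟨(Set.toFinite _).image f⟩

/-- Distinct points are distinct lines, and their union lies in a subspace whose dimension is the
rank. -/
theorem IsProjGeom.mul_ncard_add_one_le (hN : N.IsProjGeom F n) (hA : A ⊆ N.E) :
    (Nat.card F - 1) * A.ncard + 1 ≤ Nat.card F ^ N.rk A := by
  obtain ⟨I, hI, hrk⟩ := hN.exists_rk_eq hA
  rw [hI, hrk]
  rcases I.eq_empty_or_nonempty with rfl | hne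
  · rw [Set.ncard_empty]
    exact Nat.one_le_pow _ _ Nat.card_pos
  refine (ncard_le_ncard_lineUnion hne (fun p _ => p.rep_nonzero) ?_).trans ?_
  · intro p _ p' _ c hc
    rw [← p.mk_rep, ← p'.mk_rep, Projectivization.mk_eq_mk_iff']
    exact ⟨c, hc.symm⟩
  · rw [← ncard_submodule_eq_pow]
    exact Set.ncard_le_ncard (lineUnion_subset_span _ _) (Set.toFinite _)

theorem IsProjGeom.mul_ncard_ground (hN : N.IsProjGeom F n) :
    (Nat.card F - 1) * N.E.ncard + 1 = Nat.card F ^ n := by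
  obtain ⟨f, hf, rfl⟩ := hN
  have h1 := Projectivization.card' F (Fin n → F)
  rw [Nat.card_fun, Nat.card_fin] at h1
  rw [map_ground, hf.ncard_image, h1, mul_comm]
  simp [projGeom, vectorMatroid_ground, Set.ncard_univ]

theorem IsProjGeom.rk_ground (hN : N.IsProjGeom F n) : N.rk N.E = n := by
  apply le_antisymm
  · obtain ⟨I, -, hrk⟩ := hN.exists_rk_eq subset_rfl
    rw [hrk]
    exact (Submodule.finrank_le _).trans (Module.finrank_fin_fun F).le
  · have h1 := hN.mul_ncard_add_one_le subset_rfl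
    rw [hN.mul_ncard_ground] at h1
    exact (Nat.pow_le_pow_iff_right Finite.one_lt_card).1 h1

theorem IsProjGeom.le_rk_of_pow_lt (hN : N.IsProjGeom F n) (hA : A ⊆ N.E) {m : ℕ}
    (h : Nat.card F ^ m < (Nat.card F - 1) * A.ncard + 1) : m < N.rk A :=
  (Nat.pow_lt_pow_iff_right Finite.one_lt_card).1 (h.trans_le (hN.mul_ncard_add_one_le hA))

/-- In a projective geometry, the complement of a nonspanning set is large. -/
theorem IsProjGeom.pow_le_mul_ncard_compl (hN : N.IsProjGeom F n) (hA : A ⊆ N.E)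
    (h : N.rk A < n) :
    (Nat.card F - 1) * Nat.card F ^ (n - 1) ≤ (Nat.card F - 1) * (N.E \ A).ncard := by
  have := hN.matroidFinite
  have hq : 2 ≤ Nat.card F := Finite.one_lt_card
  have h1 := hN.mul_ncard_add_one_le hA
  have h2 := hN.mul_ncard_ground
  have h3 := Set.ncard_sdiff_add_ncard_of_subset hA N.ground_finite
  have h4 : Nat.card F ^ N.rk A ≤ Nat.card F ^ (n - 1) :=
    Nat.pow_le_pow_right (by omega) (by omega)
  have h5 : Nat.card F ^ n = (Nat.card F - 1) * Nat.card F ^ (n - 1) + Nat.card F ^ (n - 1) := by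
    rw [← Nat.succ_mul, Nat.succ_eq_add_one, Nat.sub_add_cancel (by omega), ← pow_succ']
    congr 1
    omega
  rw [← h3, mul_add] at h2
  omega

theorem IsProjGeom.rk_compl (hN : N.IsProjGeom F n) (hA : A ⊆ N.E) (h : N.rk A < n) :
    N.rk (N.E \ A) = n := by
  have := hN.matroidFinite
  have hq : 2 ≤ Nat.card F := Finite.one_lt_card
  have h1 := hN.pow_le_mul_ncard_compl hA h
  have h2 := Nat.mul_le_mul_right (Nat.card F ^ (n - 1)) (show 1 ≤ Nat.card F - 1 by omega)
  have h3 := hN.le_rk_of_pow_lt (Set.sdiff_subset (s := N.E) (t := A)) (m := n - 1) (by omega)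
  have h4 := N.rk_mono (Set.sdiff_subset (s := N.E) (t := A))
  rw [hN.rk_ground] at h4
  omega

theorem IsProjGeom.lam_eq_rk (hN : N.IsProjGeom F n) (hA : A ⊆ N.E) (h : N.rk A < n) :
    N.lam A = N.rk A := by
  have := hN.matroidFinite
  have h1 := N.lam_add_rk A
  rw [hN.rk_compl hA h, hN.rk_ground] at h1
  omega

/-- Cospanning would make the complement independent, but the complement has rank n and at least
q^(n−1) points. The bound n ≥ 3 gives 2^(n−1) > n. -/
theorem IsProjGeom.not_spanning_dual (hN : N.IsProjGeom F n) (hn : 3 ≤ n) (hA : A ⊆ N.E)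
    (h : N.rk A < n) : ¬ N✶.Spanning A := by
  have := hN.matroidFinite
  intro hsp
  rw [spanning_iff_compl_coindep (by simpa using hA), dual_ground, dual_coindep_iff,
    indep_iff_rk_eq_ncard _ N.ground_finite.sdiff, hN.rk_compl hA h] at hsp
  have hq : 2 ≤ Nat.card F := Finite.one_lt_card
  have h1 := Nat.le_of_mul_le_mul_left (hN.pow_le_mul_ncard_compl hA h) (by omega)
  have h2 : 2 ^ (n - 1) ≤ Nat.card F ^ (n - 1) := Nat.pow_le_pow_left hq _
  have h3 : ∀ m, m + 3 < 2 ^ (m + 2) := by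
    intro m
    induction m with
    | zero => norm_num
    | succ m ih => rw [show m + 1 + 2 = (m + 2) + 1 by ring, pow_succ]; omega
  have h4 := h3 (n - 3)
  rw [show n - 3 + 2 = n - 1 by omega] at h4
  omega

/-- The order condition in `N` follows from the one in `M` by minor monotonicity, and a nonspanning
set is never cospanning. -/
theorem IsProjGeom.mem_minorTangle_iff {M : Matroid α} [M.Finite] (hN : N.IsProjGeom F n)
    (hNM : N ≤m M) (hn : 3 ≤ n) {Z : Set α} :
    Z ∈ M.minorTangle N n ↔ Z ⊆ M.E ∧ M.lam Z + 1 < n ∧ N.rk (Z ∩ N.E) < n := by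
  have := hN.matroidFinite
  have hlam := hNM.lam_inter_le Z
  have hsp := N.spanning_iff_rk (Set.inter_subset_right (s := Z) (t := N.E))
  have hle := N.rk_le_rk_ground (Z ∩ N.E)
  rw [hN.rk_ground] at hsp hle
  constructor
  · rintro ⟨h1, h2, -, -, h3, -⟩
    rw [hsp] at h3
    exact ⟨h1, h2, by omega⟩
  · rintro ⟨h1, h2, h3⟩
    refine ⟨h1, h2, Set.inter_subset_right, by omega, ?_,
      hN.not_spanning_dual hn Set.inter_subset_right h3⟩
    rw [hsp]
    omega

end ProjGeom

/-! ### Contracting into a minimizing set -/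

section Contraction

variable {α : Type*}

/-- Let `N = M ／ C ＼ D` be a minor of `M` in which nonspanning sets have connectivity equal to
their rank, and suppose that all the sets `Z ⊇ X` that are not `N`-spanning have connectivity at
least `k`, with equality for some `Z`. Then part of `C` can be contracted such that this remains
true, `X` is not affected, and the rest of `C` lies in a minimizing set. -/
theorem exists_contract_subset_tight {M N : Matroid α} [M.Finite] {C D X : Set α} {k n : ℕ}
    (hNCD : N = M ／ C ＼ D) (hCE : C ⊆ M.E) (hXE : X ⊆ M.E) (hkn : 2 * k < n)
    (hN : ∀ A ⊆ N.E, N.rk A < n → N.lam A = N.rk A)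
    (hk : ∀ Z, X ⊆ Z → Z ⊆ M.E → N.rk (Z ∩ N.E) < n → k ≤ M.lam Z)
    (hex : ∃ Z, X ⊆ Z ∧ Z ⊆ M.E ∧ N.rk (Z ∩ N.E) < n ∧ M.lam Z = k) :
    ∃ S Z, S ⊆ C \ X ∧ N ≤m M ／ S ∧ M.rk (X ∪ S) = M.rk X + M.rk S ∧
      X ⊆ Z ∧ Z ⊆ (M ／ S).E ∧ C \ S ⊆ Z ∧ (M ／ S).lam Z = k ∧ N.rk (Z ∩ N.E) ≤ k ∧
      ∀ Z', X ⊆ Z' → Z' ⊆ (M ／ S).E → N.rk (Z' ∩ N.E) < n → k ≤ (M ／ S).lam Z' := by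
  have hNC : ∀ c ∈ C, c ∉ N.E := by
    rw [hNCD]
    exact fun c hc h => h.1.2 hc
  have hminor : ∀ S ⊆ C, N ≤m M ／ S := by
    intro S hS
    refine ⟨C \ S, D, ?_⟩
    rw [contract_contract, Set.union_sdiff_cancel hS, hNCD]
  have hNfin : N.Finite := (hminor ∅ (Set.empty_subset _)).matroidFinite
  let s : Set (Set α) := {S | S ⊆ C \ X ∧ M.rk (X ∪ S) = M.rk X + M.rk S ∧
    ∀ Z, X ⊆ Z → Z ⊆ (M ／ S).E → N.rk (Z ∩ N.E) < n → k ≤ (M ／ S).lam Z}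
  have hsfin : s.Finite :=
    (M.ground_finite.subset hCE).finite_subsets.subset fun S hS => hS.1.trans Set.sdiff_subset
  have hsne : s.Nonempty := ⟨∅, Set.empty_subset _, by simp [rk_empty], by simpa using hk⟩
  obtain ⟨S, ⟨hSC, hXS, hSk⟩, hSmax⟩ := hsfin.exists_maximal hsne
  have hSC' : S ⊆ C := hSC.trans Set.sdiff_subset
  have hXSd : Disjoint X S := (Set.subset_sdiff.1 hSC).2.symm
  set M₁ := M ／ S with hM₁
  have hNM₁ : N ≤m M₁ := hminor S hSC'
  have hXM₁ : X ⊆ M₁.E := Set.subset_sdiff.2 ⟨hXE, hXSd⟩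
  have hsmall : ∀ Z, N.rk (Z ∩ N.E) < n → N.rk (Z ∩ N.E) ≤ M₁.lam Z := by
    intro Z hZ
    rw [← hN _ Set.inter_subset_right hZ]
    exact hNM₁.lam_inter_le Z
  let tight : Set (Set α) := {Z | X ⊆ Z ∧ Z ⊆ M₁.E ∧ N.rk (Z ∩ N.E) < n ∧ M₁.lam Z ≤ k}
  have htfin : tight.Finite := M₁.ground_finite.finite_subsets.subset fun Z hZ => hZ.2.1
  have htne : tight.Nonempty := by
    obtain ⟨Z, hXZ, hZE, hZn, hZk⟩ := hex
    refine ⟨Z \ S, Set.subset_sdiff.2 ⟨hXZ, hXSd⟩, Set.sdiff_subset_sdiff_left hZE, ?_, ?_⟩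
    · exact (N.rk_mono (Set.inter_subset_inter_left _ Set.sdiff_subset)).trans_lt hZn
    · exact (M.lam_contract_le S Z).trans hZk.le
  obtain ⟨Z, ⟨hXZ, hZE, hZn, hZk⟩, hZmax⟩ := htfin.exists_maximal htne
  have hc_inter : ∀ c ∈ C, ∀ Z : Set α, (Z ∪ {c}) ∩ N.E = Z ∩ N.E := by
    intro c hc Z
    rw [Set.union_inter_distrib_right, Set.singleton_inter_eq_empty.2 (hNC c hc), Set.union_empty]
  refine ⟨S, Z, hSC, hNM₁, hXS, hXZ, hZE, ?_, le_antisymm hZk (hSk Z hXZ hZE hZn),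
    (hsmall Z hZn).trans hZk, hSk⟩
  rintro c ⟨hcC, hcS⟩
  by_contra hcZ
  have hcX : c ∉ X := fun h => hcZ (hXZ h)
  have hcE : c ∈ M₁.E := ⟨hCE hcC, hcS⟩
  -- If `X` spans c, adding c to `Z` does not raise its connectivity, against maximality of `Z`.
  -- Otherwise c is skew to `X`, so by maximality of `S` contracting c breaks the bound at some
  -- `Z'`.
  by_cases hcl : M₁.rk (X ∪ {c}) = M₁.rk X
  · refine hcZ (hZmax (y := Z ∪ {c}) ⟨hXZ.trans Set.subset_union_left,
      Set.union_subset hZE (by simpa using hcE), ?_, ?_⟩ Set.subset_union_left (Or.inr rfl))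
    · rwa [hc_inter c hcC]
    · have h1 := M₁.lam_add_rk Z
      have h2 := M₁.lam_add_rk (Z ∪ {c})
      have h3 := M₁.rk_union_eq_of_subset hcl hXZ
      have h4 := M₁.rk_mono (Set.sdiff_subset_sdiff_right (Set.subset_union_left (s := Z) (t := {c}))
        : M₁.E \ (Z ∪ {c}) ⊆ M₁.E \ Z)
      omega
  · have hX1 := M.rk_contract_add S X
    have hX2 := M.rk_contract_add S (X ∪ {c})
    have hX3 := M.rk_contract_add S {c}
    rw [← hM₁] at hX1 hX2 hX3
    have hc1 := M₁.rk_singleton_le c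
    have hX4 := M₁.rk_mono (Set.subset_union_left (s := X) (t := {c}))
    have hX5 := M₁.rk_union_le X {c}
    have hskew : M.rk (X ∪ insert c S) = M.rk X + M.rk (insert c S) := by
      rw [Set.insert_eq, ← Set.union_assoc]
      omega
    have hMc : M ／ insert c S = M₁ ／ {c} := by
      rw [hM₁, contract_contract, Set.union_singleton]
    have hex' : ∃ Z', X ⊆ Z' ∧ Z' ⊆ (M₁ ／ {c}).E ∧ N.rk (Z' ∩ N.E) < n ∧
        (M₁ ／ {c}).lam Z' < k := by
      by_contra! hcon
      refine hcS (hSmax (y := insert c S) ⟨Set.insert_subset ⟨hcC, hcX⟩ hSC, hskew, ?_⟩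
        (Set.subset_insert c S) (Set.mem_insert c S))
      rw [hMc]
      exact hcon
    obtain ⟨Z', hXZ', hZ'E, hZ'n, hZ'k⟩ := hex'
    have hZ'M : Z' ⊆ M₁.E := hZ'E.trans (M₁.contract_ground_subset_ground _)
    have htop : M₁.lam (Z' ∪ {c}) ≤ k := by
      have h1 := (M₁ ／ {c}).lam_add_rk Z'
      have h2 := M₁.lam_add_rk (Z' ∪ {c})
      have h3 := M₁.rk_contract_add {c} Z'
      have h4 := M₁.rk_contract_add {c} ((M₁ ／ {c}).E \ Z')
      have h5 := M₁.rk_contract_add {c} (M₁ ／ {c}).E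
      have h6 : M₁.rk (M₁.E \ (Z' ∪ {c})) ≤ M₁.rk ((M₁ ／ {c}).E \ Z' ∪ {c}) := by
        refine M₁.rk_mono fun x hx => Or.inl ⟨⟨hx.1, fun h => hx.2 (Or.inr h)⟩,
          fun h => hx.2 (Or.inl h)⟩
      have h7 : (M₁ ／ {c}).E ∪ {c} = M₁.E :=
        Set.sdiff_union_of_subset (by simpa using hcE)
      rw [h7] at h5
      omega
    have hZ'cE : Z' ∪ {c} ⊆ M₁.E := Set.union_subset hZ'M (by simpa using hcE)
    have hZ'n' : N.rk ((Z' ∪ {c}) ∩ N.E) < n := by rwa [hc_inter c hcC]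
    have hmeet : k ≤ M₁.lam (Z ∩ (Z' ∪ {c})) :=
      hSk _ (Set.subset_inter hXZ (hXZ'.trans Set.subset_union_left))
        (Set.inter_subset_left.trans hZE) ((N.rk_mono
          (Set.inter_subset_inter_left _ Set.inter_subset_left)).trans_lt hZn)
    -- The intersection has connectivity at least k, so the union has at most k. Both sets have rank
    -- at most k in `N`, and 2k < n keeps the union nonspanning, which contradicts maximality of
    -- `Z`.
    have hsub := M₁.lam_submod Z (Z' ∪ {c})
    refine hcZ (hZmax (y := Z ∪ (Z' ∪ {c})) ⟨hXZ.trans Set.subset_union_left,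
      Set.union_subset hZE hZ'cE, ?_, by omega⟩ Set.subset_union_left (Or.inr (Or.inr rfl)))
    have h1 := hsmall _ hZn
    have h2 := hsmall _ hZ'n'
    have h3 := N.rk_union_le (Z ∩ N.E) ((Z' ∪ {c}) ∩ N.E)
    rw [← Set.union_inter_distrib_right] at h3
    omega

end Contraction

/-! ### Assembly -/

section Main

open Module Submodule

variable {F α : Type*} [Field F] {M : Matroid α}

theorem IsRepresentableOver.exists_rk_eq {X : Set α} (h : (M ＼ X).IsRepresentableOver F) :
    ∃ (m : ℕ) (v : α → Fin m → F),
      ∀ A ⊆ M.E \ X, M.rk A = finrank F (span F (v '' A)) := by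
  obtain ⟨m, v, hv⟩ := h
  refine ⟨m, v, fun A hA => ?_⟩
  rw [← M.rk_delete (Set.subset_sdiff.1 hA).2, hv]
  exact rk_vectorMatroid hA

/-- A set whose rank does not drop much when few elements are removed has a large subset whose rank
does not drop at all when few elements are removed. -/
theorem exists_robust_subset (M : Matroid α) [M.Finite] {Y₀ : Set α} (hY₀ : Y₀ ⊆ M.E) {n k c w : ℕ}
    (hn : n ≤ M.rk Y₀) (hnk : M.rk Y₀ ≤ n + k)
    (hlarge : ∀ Y ⊆ Y₀, w * (Y₀ \ Y).ncard ≤ c * (k + 1) → n ≤ M.rk Y) :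
    ∃ Y ⊆ Y₀, n ≤ M.rk Y ∧ w * (Y₀ \ Y).ncard ≤ c * k ∧
      ∀ Y₁ ⊆ Y, w * Y₁.ncard < c → M.rk (Y \ Y₁) = M.rk Y := by
  have hfin : Y₀.Finite := M.ground_finite.subset hY₀
  -- In this potential a rank drop of one saves c, while removing a set of weight below c costs less
  -- than c; a minimizer therefore admits no such drop.
  obtain ⟨Y, ⟨hYY₀, hYn⟩, hmin⟩ := (hfin.finite_subsets.subset
    (fun Y hY => hY.1 : {Y | Y ⊆ Y₀ ∧ n ≤ M.rk Y} ⊆ {Y | Y ⊆ Y₀})).exists_minimalFor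
    (fun Y => c * M.rk Y + w * (Y₀ \ Y).ncard) _ ⟨Y₀, subset_rfl, hn⟩
  have hmin' : ∀ Y' ⊆ Y₀, n ≤ M.rk Y' →
      c * M.rk Y + w * (Y₀ \ Y).ncard ≤ c * M.rk Y' + w * (Y₀ \ Y').ncard := by
    intro Y' h1 h2
    by_contra! hlt
    exact (hmin (j := Y') ⟨h1, h2⟩ hlt.le).not_gt hlt
  have hcard : w * (Y₀ \ Y).ncard ≤ c * k := by
    have h1 := hmin' Y₀ subset_rfl hn
    rw [sdiff_self, Set.bot_eq_empty, Set.ncard_empty, mul_zero, add_zero] at h1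
    have h2 := Nat.mul_le_mul_left c hnk
    have h3 := Nat.mul_le_mul_left c hYn
    rw [mul_add] at h2
    omega
  refine ⟨Y, hYY₀, hYn, hcard, fun Y₁ hY₁ hlt => ?_⟩
  have hsub : Y \ Y₁ ⊆ Y₀ := Set.sdiff_subset.trans hYY₀
  have hc1 : w * (Y₀ \ (Y \ Y₁)).ncard ≤ w * (Y₀ \ Y).ncard + w * Y₁.ncard := by
    rw [← mul_add]
    refine Nat.mul_le_mul_left _ ((Set.ncard_le_ncard ?_ ((hfin.sdiff).union
      (hfin.subset (hY₁.trans hYY₀)))).trans (Set.ncard_union_le _ _))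
    intro x hx
    by_cases hxY : x ∈ Y
    · exact Or.inr (by_contra fun h => hx.2 ⟨hxY, h⟩)
    · exact Or.inl ⟨hx.1, hxY⟩
  have h1 := hmin' (Y \ Y₁) hsub (hlarge _ hsub (by rw [mul_add, mul_one]; omega))
  have h2 := M.rk_mono (Set.sdiff_subset (s := Y) (t := Y₁))
  by_contra hne
  have h3 := Nat.mul_le_mul_left c (show M.rk (Y \ Y₁) + 1 ≤ M.rk Y by omega)
  rw [mul_add] at h3
  omega

theorem rk_lt_two_of_eq_smul {V : Type*} [AddCommGroup V] [Module F V] {v : α → V} {y y' : α}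
    {c : F} (h : v y = c • v y') : finrank F (span F (v '' {y, y'})) < 2 := by
  have h1 : span F (v '' {y, y'}) ≤ span F {v y'} := by
    rw [span_le, Set.image_pair, h]
    rintro x (rfl | rfl)
    · exact smul_mem _ _ (mem_span_singleton_self _)
    · exact mem_span_singleton_self _
  have h2 := Submodule.finrank_mono h1
  have h3 := finrank_span_le_card (R := F) ({v y'} : Set V)
  simp only [Set.toFinset_singleton, Finset.card_singleton] at h3
  omega

variable [Finite F]

/-- If every set containing `X` that does not span the projective geometry minor `N` has
connectivity at least `k`, with equality for some set, then some minor links `X` with order `k` to a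
projective geometry restriction of smaller rank. -/
theorem exists_projGeom_minor_of_connectivity [M.Finite] {N : Matroid α} {X : Set α} {h k n : ℕ}
    (hNM : N ≤m M) (hN : N.IsProjGeom F n) (hh : 0 < h) (hkh : k ≤ h)
    (hn : h * Nat.card F ^ (h + k) + 2 * h + 4 * k + 2 ≤ n) (hXE : X ⊆ M.E)
    (hrep : (M ＼ X).IsRepresentableOver F)
    (hk : ∀ Z, X ⊆ Z → Z ⊆ M.E → N.rk (Z ∩ N.E) < n → k ≤ M.lam Z)
    (hex : ∃ Z, X ⊆ Z ∧ Z ⊆ M.E ∧ N.rk (Z ∩ N.E) < n ∧ M.lam Z = k) :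
    ∃ M' N' : Matroid α, M' ≤m M ∧ N' ≤r M' ∧ N'.IsProjGeom F h ∧
      M'.E = N'.E ∪ X ∧ M' ↾ X = M ↾ X ∧ M'.lam X = k := by
  have hNfin := hN.matroidFinite
  obtain ⟨C, D, hCE, -, -, hNCD⟩ := hNM.exists_eq_contract_delete_disjoint
  obtain ⟨S, Z, hSC, hNM₁, hXS, hXZ, hZE, hCZ, hZk, hZN, hk₁⟩ :=
    exists_contract_subset_tight hNCD hCE hXE (by omega) (fun A hA => hN.lam_eq_rk hA) hk hex
  obtain ⟨m, v, hv⟩ := hrep.exists_rk_eq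
  have hq2 : 2 ≤ Nat.card F := Finite.one_lt_card
  have hSM : S ⊆ M.E \ X := hSC.trans (Set.sdiff_subset_sdiff_left hCE)
  have hXM₁ : X ⊆ (M ／ S).E := hXZ.trans hZE
  -- the projective geometry outside the minimizing set
  set Y₀ := N.E \ Z with hY₀
  have hY₀N : Y₀ ⊆ N.E := Set.sdiff_subset
  have hY₀M₁ : Y₀ ⊆ (M ／ S).E := hY₀N.trans hNM₁.subset
  have hY₀eq : N.E \ (Z ∩ N.E) = Y₀ := by rw [Set.inter_comm, Set.sdiff_self_inter]
  have hNY₀ : N.rk Y₀ = n := by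
    rw [← hY₀eq]
    exact hN.rk_compl Set.inter_subset_right (by omega)
  have hY₀n : n ≤ (M ／ S).rk Y₀ := by
    rw [← hNY₀]
    exact hNM₁.rk_le _ hY₀N
  -- `C \ S` and `Y₀` lie on opposite sides of a separation of order k, so contracting `C \ S`
  -- lowers the rank of `Y₀` by at most k, to n.
  have hY₀nk : (M ／ S).rk Y₀ ≤ n + k := by
    have h1 := (M ／ S).rk_add_rk_le_lam (A := C \ S) (B := Y₀) (Z := Z) hCZ
      (Set.sdiff_subset_sdiff_left hNM₁.subset)
    have h2 : (M ／ S).rk (C \ S ∪ Y₀) = N.rk Y₀ + (M ／ S).rk (C \ S) := by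
      have hd : Disjoint Y₀ D := by
        have : N.E ⊆ (M ／ C).E \ D := by rw [hNCD]; rfl
        exact (Set.subset_sdiff.1 (hY₀N.trans this)).2
      rw [hNCD, rk_delete _ hd, Set.union_comm, ← (M ／ S).rk_contract_add, contract_contract,
        Set.union_sdiff_cancel (hSC.trans Set.sdiff_subset)]
    omega
  -- numerical bounds
  set c := Nat.card F ^ (h * Nat.card F ^ (h + k) + 2 * k) with hc
  have hqk : Nat.card F ^ k ≤ c := Nat.pow_le_pow_right (by omega) (by omega)
  have hcard₀ : Nat.card F ^ n ≤ (Nat.card F - 1) * Y₀.ncard + Nat.card F ^ k := by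
    have h1 := hN.mul_ncard_ground
    have h2 := hN.mul_ncard_add_one_le (Set.inter_subset_right (s := Z) (t := N.E))
    have h3 := Set.ncard_sdiff_add_ncard_of_subset (Set.inter_subset_right (s := Z) (t := N.E))
      N.ground_finite
    rw [hY₀eq] at h3
    rw [← h3, mul_add] at h1
    have h4 := Nat.pow_le_pow_right (n := Nat.card F) (by omega) hZN
    omega
  have hck : c * (k + 1) ≤ Nat.card F ^ (h * Nat.card F ^ (h + k) + 3 * k) := by
    have : k + 1 ≤ Nat.card F ^ k := Nat.lt_pow_self hq2
    calc c * (k + 1) ≤ c * Nat.card F ^ k := Nat.mul_le_mul_left _ this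
      _ = Nat.card F ^ (h * Nat.card F ^ (h + k) + 3 * k) := by rw [hc, ← pow_add]; congr 1; ring
  have hcount : ∀ Y ⊆ Y₀, (Nat.card F - 1) * (Y₀ \ Y).ncard ≤ c * (k + 1) → n ≤ N.rk Y := by
    intro Y hY hle
    have h1 := Set.ncard_sdiff_add_ncard_of_subset hY ((M ／ S).ground_finite.subset hY₀M₁)
    rw [← h1, mul_add] at hcard₀
    have h2 : Nat.card F ^ (h * Nat.card F ^ (h + k) + 3 * k) ≤ Nat.card F ^ (n - 2) := Nat.pow_le_pow_right (by omega) (by omega)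
    have h3 : c ≤ Nat.card F ^ (n - 2) := Nat.pow_le_pow_right (by omega) (by omega)
    have h4 : Nat.card F ^ n = Nat.card F * Nat.card F ^ (n - 1) := by rw [← pow_succ']; congr 1; omega
    have h5 : Nat.card F ^ (n - 1) = Nat.card F * Nat.card F ^ (n - 2) := by rw [← pow_succ']; congr 1; omega
    have h6 := Nat.mul_le_mul_right (Nat.card F ^ (n - 1)) hq2
    have h7 := Nat.mul_le_mul_right (Nat.card F ^ (n - 2)) hq2
    have h8 := hN.le_rk_of_pow_lt (hY.trans hY₀N) (m := n - 1) (by omega)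
    omega
  -- With weight q − 1 per element, the exponent of `c` is the rank threshold of the robustness
  -- needed later: a set of rank at most that threshold has weight below `c`.
  obtain ⟨Y, hYY₀, hYn, hYcard, hYrob⟩ := exists_robust_subset (M ／ S) hY₀M₁ hY₀n hY₀nk
    (fun Y hY hle => (hcount Y hY hle).trans (hNM₁.rk_le _ (hY.trans hY₀N)))
  have hYN : Y ⊆ N.E := hYY₀.trans hY₀N
  have hYM₁ : Y ⊆ (M ／ S).E := hYY₀.trans hY₀M₁
  have hYZ : Disjoint Z Y := Set.disjoint_sdiff_right.mono_right hYY₀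
  have hXY : Disjoint X Y := hYZ.mono_left hXZ
  have hNY : n ≤ N.rk Y := hcount Y hYY₀ (hYcard.trans (Nat.mul_le_mul_left _ (by omega)))
  -- link `X` to `Y`
  obtain ⟨M₂, hM₂, hM₂E, hM₂X, hM₂Y, hM₂k⟩ := exists_minor_linking (M ／ S) hXM₁ hYM₁ hXY k (by
    intro A hXA hA
    by_cases hsm : N.rk (A ∩ N.E) < n
    · exact hk₁ A hXA (hA.trans Set.sdiff_subset) hsm
    -- Here `A` spans `N`, and so does its complement, which contains `Y`; hence λ(A) ≥ n.
    have h1 := hNM₁.lam_inter_le A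
    have h2 := N.lam_add_rk (A ∩ N.E)
    have h3 : N.rk Y ≤ N.rk (N.E \ (A ∩ N.E)) :=
      N.rk_mono fun y hy => ⟨hYN hy, fun h => (hA h.1).2 hy⟩
    rw [hN.rk_ground] at h2
    omega)
  have hM₂fin : M₂.Finite := hM₂.matroidFinite
  have hlam₂ : M₂.lam X = k := by
    have h1 := hM₂.lam_inter_le Z
    have h2 : Z ∩ M₂.E = X := by
      rw [hM₂E, Set.inter_union_distrib_left, hYZ.inter_eq, Set.union_empty,
        Set.inter_eq_self_of_subset_right hXZ]
    rw [h2] at h1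
    omega
  have hrk₂ : ∀ A ⊆ Y, M₂.rk A = (M ／ S).rk A := fun A hA => rk_eq_of_restrict_eq hM₂Y hA
  -- the representation of `Y`
  let v' : α → (Fin m → F) ⧸ span F (v '' S) := fun x => (span F (v '' S)).mkQ (v x)
  have hYM : Y ⊆ M.E \ X :=
    Set.subset_sdiff.2 ⟨hYM₁.trans (M.contract_ground_subset_ground S), hXY.symm⟩
  have hv' : ∀ A ⊆ Y, M₂.rk A = finrank F (span F (v' '' A)) := by
    intro A hA
    have h1 := M.rk_contract_add S A
    have h2 := finrank_span_mkQ_add (F := F) v A S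
    rw [← hv S hSM, ← hv (A ∪ S) (Set.union_subset (hA.trans hYM) hSM)] at h2
    change finrank F (span F (v' '' A)) + _ = _ at h2
    rw [hrk₂ A hA]
    omega
  have hpair : ∀ y ∈ Y, ∀ y' ∈ Y, ∀ b : F, v' y = b • v' y' → y = y' := by
    intro y hy y' hy' b hb
    by_contra hne
    have hsub : {y, y'} ⊆ Y := Set.insert_subset hy (Set.singleton_subset_iff.2 hy')
    have h1 := rk_lt_two_of_eq_smul hb
    rw [← hv' _ hsub, hrk₂ _ hsub] at h1
    have h2 := hN.le_rk_of_pow_lt (hsub.trans hYN) (m := 1) (by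
      rw [Set.ncard_pair hne, pow_one]
      omega)
    have h3 := hNM₁.rk_le _ (hsub.trans hYN)
    omega
  have hne0 : ∀ y ∈ Y, v' y ≠ 0 := by
    intro y hy h0
    have hsub : {y} ⊆ Y := Set.singleton_subset_iff.2 hy
    have h1 := hv' _ hsub
    rw [Set.image_singleton, h0, span_zero_singleton, finrank_bot, hrk₂ _ hsub] at h1
    have h2 := hN.le_rk_of_pow_lt (hsub.trans hYN) (m := 0) (by
      rw [Set.ncard_singleton, pow_zero]
      omega)
    have h3 := hNM₁.rk_le _ (hsub.trans hYN)
    omega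
  have hYne : Y.Nonempty := by
    by_contra hcon
    rw [Set.not_nonempty_iff_eq_empty] at hcon
    rw [hcon, rk_empty] at hNY
    omega
  have hlines := ncard_le_ncard_lineUnion hYne hne0 hpair
  -- The rank of `Y` is at most n + k. The factor q^k + 1, rather than q^k, leaves a surplus q^n
  -- that absorbs the discarded points.
  have hdense : Nat.card F ^ M₂.rk Y < (Nat.card F ^ k + 1) * (lineUnion F v' Y).ncard := by
    rw [hrk₂ Y subset_rfl]
    have h1 := Set.ncard_sdiff_add_ncard_of_subset hYY₀ ((M ／ S).ground_finite.subset hY₀M₁)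
    rw [← h1, mul_add] at hcard₀
    have h2 : Nat.card F ^ n < (lineUnion F v' Y).ncard + c * (k + 1) := by
      rw [mul_add]
      omega
    have h3 : (M ／ S).rk Y ≤ n + k := ((M ／ S).rk_mono hYY₀).trans hY₀nk
    have h4 : Nat.card F ^ (M ／ S).rk Y ≤ Nat.card F ^ k * Nat.card F ^ n := by
      rw [← pow_add]
      exact Nat.pow_le_pow_right (by omega) (by omega)
    have h5 : (Nat.card F ^ k + 1) * (c * (k + 1)) ≤ Nat.card F ^ n := by
      refine (Nat.mul_le_mul (pow_add_one_le_pow_succ hq2 k) hck).trans ?_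
      rw [← pow_add]
      exact Nat.pow_le_pow_right (by omega) (by omega)
    have h6 := Nat.mul_lt_mul_of_pos_left h2 (show 0 < Nat.card F ^ k + 1 by omega)
    rw [mul_add, add_mul] at h6
    omega
  obtain ⟨M', N', hM', hN', hPG, hE', hX', hl'⟩ := exists_projGeom_minor_of_dense M₂ hh hkh hM₂E
    hXY hlam₂ hv' hdense (by rw [hrk₂ Y subset_rfl]; omega) (by
      intro Y₁ hY₁ hle
      rw [hrk₂ _ hY₁] at hle
      rw [hrk₂ _ Set.sdiff_subset, hrk₂ Y subset_rfl]
      refine hYrob Y₁ hY₁ ?_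
      have h1 := hN.mul_ncard_add_one_le (hY₁.trans hYN)
      have h2 := (hNM₁.rk_le _ (hY₁.trans hYN)).trans hle
      have h3 := Nat.pow_le_pow_right (n := Nat.card F) (by omega) h2
      omega)
  refine ⟨M', N', hM'.trans (hM₂.trans (M.contract_isMinor S)), hN', hPG, hE',
    hX'.trans (hM₂X.trans ?_), hl'⟩
  refine restrict_eq_restrict_of_rk (M.ground_finite.subset hXE) fun A hA => ?_
  have h1 := M.rk_contract_add S A
  have h2 := M.rk_union_eq_add_of_subset hXS hA
  omega

end Main

end Matroid

theorem mainTheorem7 {α : Type*} (F : Type*) [Field F] [Finite F]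
    (q : ℕ) (hq : Nat.card F = q) (h a n : ℕ) (ha : 0 < a) (hah : a ≤ h)
    (hn : n = 2 * h * (1 + q ^ (h + a)) + a + 2)
    (M N : Matroid α) [M.Finite] (hNM : N ≤m M) (hN : N.IsProjGeom F n)
    (X : Set α) (hXE : X ⊆ M.E) (hX : M.rk X ≤ a)
    (hrep : (M ＼ X).IsRepresentableOver F) :
    ∃ M' N' : Matroid α, M' ≤m M ∧ N' ≤r M' ∧ N'.IsProjGeom F h ∧
      M'.E = N'.E ∪ X ∧ M' ↾ X = M ↾ X ∧
      M'.lam X = M.tangleConn (M.minorTangle N n) n X := by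
  have hNfin := hN.matroidFinite
  subst hq
  have hq2 : 2 ≤ Nat.card F := Finite.one_lt_card
  -- The second copy of h q^(h+a) in n is used only to absorb the term 4k, through 4k ≤ 4h.
  have hpow : 4 ≤ Nat.card F ^ (h + a) :=
    calc 4 = 2 ^ 2 := rfl
      _ ≤ 2 ^ (h + a) := Nat.pow_le_pow_right (by omega) (by omega)
      _ ≤ _ := Nat.pow_le_pow_left hq2 _
  have hn' : n = 2 * (h * Nat.card F ^ (h + a)) + 2 * h + a + 2 := by
    rw [hn]
    ring
  have hL4 : h * 4 ≤ h * Nat.card F ^ (h + a) := Nat.mul_le_mul_left h hpow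
  have hmem : ∀ Z, Z ∈ M.minorTangle N n ↔ Z ⊆ M.E ∧ M.lam Z + 1 < n ∧ N.rk (Z ∩ N.E) < n :=
    fun Z => hN.mem_minorTangle_iff hNM (by omega)
  have hXlam : M.lam X ≤ a := (M.lam_le_rk X).trans hX
  -- Because `X` itself is small, the default value n − 1 never occurs and k ≤ a.
  have hXT : X ∈ M.minorTangle N n := by
    refine (hmem X).2 ⟨hXE, by omega, ?_⟩
    have h1 := hNM.rk_le (X ∩ N.E) Set.inter_subset_right
    have h2 := M.rk_mono (Set.inter_subset_left (s := X) (t := N.E))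
    omega
  have hconn : M.tangleConn (M.minorTangle N n) n X =
      sInf {m | ∃ Z ∈ M.minorTangle N n, X ⊆ Z ∧ M.lam Z = m} := by
    rw [Matroid.tangleConn, if_pos ⟨X, hXT, subset_rfl⟩]
  rw [hconn]
  set k := sInf {m | ∃ Z ∈ M.minorTangle N n, X ⊆ Z ∧ M.lam Z = m}
  have hkmin : ∀ Z ∈ M.minorTangle N n, X ⊆ Z → k ≤ M.lam Z :=
    fun Z hZ hXZ => Nat.sInf_le ⟨Z, hZ, hXZ, rfl⟩
  have hka : k ≤ a := (hkmin X hXT subset_rfl).trans hXlam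
  have hLk : h * Nat.card F ^ (h + k) ≤ h * Nat.card F ^ (h + a) :=
    Nat.mul_le_mul_left h (Nat.pow_le_pow_right (by omega) (by omega))
  obtain ⟨Z₀, hZ₀, hXZ₀, hZ₀k⟩ : k ∈ {m | ∃ Z ∈ M.minorTangle N n, X ⊆ Z ∧ M.lam Z = m} :=
    Nat.sInf_mem ⟨_, X, hXT, subset_rfl, rfl⟩
  obtain ⟨hZ₀E, -, hZ₀n⟩ := (hmem Z₀).1 hZ₀
  refine Matroid.exists_projGeom_minor_of_connectivity hNM hN (by omega) (by omega) (by omega) hXE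
    hrep (fun Z hXZ hZE hZn => ?_) ⟨Z₀, hXZ₀, hZ₀E, hZ₀n, hZ₀k⟩
  by_cases hlt : M.lam Z + 1 < n
  · exact hkmin Z ((hmem Z).2 ⟨hZE, hlt, hZn⟩) hXZ
  -- Such a `Z` lies outside the tangle, but λ(Z) ≥ n − 1 already exceeds k.
  · omega
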